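/- Let $\mathfrak g$ be a finite-dimensional complex semisimple Lie algebra with Cartan subalgebra $\mathfrak h$, root system $\Phi\subset\mathfrak h^*$, simple roots $\Pi$, positive roots $\Phi^+$ and Weyl group $W$ with length function $\ell$. Let $R=S(\mathfrak h^*)$, graded with $\deg\mathfrak h^*=2$, let $I_W\subset R$ be the ideal generated by the homogeneous $W$-invariants of positive degree, and let $C=R/I_W$ be the coinvariant algebra. For $\alpha\in\Pi$ with reflection $s_\alpha$ put $\Delta_{s_\alpha}(f)=(f-s_\alpha f)/\alpha$ for $f\in R$, and for $w\in W$ put $\Delta_w=\Delta_{s_1}\cdots\Delta_{s_k}$, where $w=s_1\cdots s_k$ is a reduced expression (any reduced expression may be used). For $J\subset\Pi$ let $W_J=\langle s_\alpha:\alpha\in J\rangle$ with longest element $w_J$, let $C^J=C^{W_J}$, with the grading inherited from $C$, and let $\mu_J=\prod_{\alpha\in\Phi_J^+}\alpha$, where $\Phi_J=\Phi\cap\mathbb ZJ$ and $\Phi_J^+=\Phi_J\cap\Phi^+$. For a graded algebra $A$ let $A\text{-gmod}$ be the category of finite-dimensional $\mathbb Z$-graded left $A$-modules with degree-preserving $A$-linear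 maps. For a graded module $M$ and $k\in\mathbb Z$ let $M\langle k\rangle$ be the shifted module with $M\langle k\rangle_d=M_{d-k}$. Let $\operatorname{res}\colon C\text{-gmod}\to C^J\text{-gmod}$ be restriction, and let $\operatorname{ind}=C\otimes_{C^J}-\colon C^J\text{-gmod}\to C\text{-gmod}$. Then for every $J\subset\Pi$: 1. $C$ is a free $C^J$-module with basis $\{\Delta_w(\mu_J)+I_W \mid w\in W_J\}$ (indexed by $W_J$). 2. The functors $\operatorname{ind}$ and $\operatorname{res}$ are graded, that is, they commute with all grading shifts up to natural isomorphism, and $(\operatorname{ind},\operatorname{res})$ and $(\operatorname{res},\operatorname{ind}\langle-2\ell(w_J)\rangle)$ are adjoint pairs of functors (left adjoint first). -/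

import Mathlib

open CategoryTheory TensorProduct

universe u v

/-! ### Graded modules -/

namespace GradedRep

section Internal

variable {K : Type v} [Field K] {M : Type u} [AddCommGroup M] [Module K M]

/-- A family of subspaces that spans `M` and is separated by additive projections is a direct sum
decomposition of `M`. -/
theorem isInternal_of_proj (ℳ : ℤ → Submodule K M) (p : ℤ → M →+ M)
    (hp : ∀ d, ∀ x ∈ ℳ d, p d x = x) (hq : ∀ d e, d ≠ e → ∀ x ∈ ℳ e, p d x = 0)
    (hs : ⨆ d, ℳ d = ⊤) : DirectSum.IsInternal ℳ := by
  rw [DirectSum.isInternal_submodule_iff_iSupIndep_and_iSup_eq_top]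
  refine ⟨?_, hs⟩
  rw [iSupIndep_def]
  intro d
  rw [Submodule.disjoint_def]
  intro x hx hx'
  rw [← hp d x hx]
  clear hx
  induction hx' using Submodule.iSup_induction' with
  | mem e y hy =>
    by_cases h : e = d
    · subst h; simp at hy; simp [hy]
    · simp only [ne_eq, h, not_false_eq_true, iSup_pos] at hy
      exact hq d e (Ne.symm h) y hy
  | zero => simp
  | add y z _ _ hy hz => simp [hy, hz]

/-- The projections to the components of a direct sum decomposition. -/
theorem exists_proj {ℳ : ℤ → Submodule K M} (h : DirectSum.IsInternal ℳ) :
    ∃ p : ℤ → M →ₗ[K] M, (∀ d x, p d x ∈ ℳ d) ∧ (∀ d, ∀ x ∈ ℳ d, p d x = x) ∧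
      (∀ d e, d ≠ e → ∀ x ∈ ℳ e, p d x = 0) ∧
      (∀ x, ∃ s : Finset ℤ, x = ∑ d ∈ s, p d x) := by
  classical
  let _ := h.chooseDecomposition
  refine ⟨fun d => (ℳ d).subtype ∘ₗ DirectSum.component K ℤ (fun i => ℳ i) d ∘ₗ
    (DirectSum.decomposeLinearEquiv ℳ).toLinearMap, ?_, ?_, ?_, ?_⟩
  · intro d x
    simp
  · intro d x hx
    exact DirectSum.decompose_of_mem_same ℳ hx
  · intro d e hde x hx
    exact DirectSum.decompose_of_mem_ne ℳ hx (Ne.symm hde)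
  · intro x
    exact ⟨_, (DirectSum.sum_support_decompose ℳ x).symm⟩

end Internal

variable {K : Type v} [Field K]

/-- A finite-dimensional `ℤ`-graded (left) module over a commutative `K`-algebra `A` graded by the
subspaces `𝒜 d`. -/
structure FinGrMod {A : Type u} [CommRing A] [Algebra K A] (𝒜 : ℤ → Submodule K A) where
  carrier : Type u
  [addCommGroup : AddCommGroup carrier]
  [moduleBase : Module K carrier]
  [module : Module A carrier]
  [isScalarTower : IsScalarTower K A carrier]
  [finite : Module.Finite K carrier]
  /-- The homogeneous component of degree `d`. -/
  deg : ℤ → Submodule K carrier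
  isInternal : DirectSum.IsInternal deg
  smul_mem : ∀ (i j : ℤ) (a : A) (m : carrier), a ∈ 𝒜 i → m ∈ deg j → a • m ∈ deg (i + j)

namespace FinGrMod

attribute [instance] addCommGroup moduleBase module isScalarTower finite

section Category

variable {A : Type u} [CommRing A] [Algebra K A] {𝒜 : ℤ → Submodule K A}

/-- A morphism of graded modules: an `A`-linear map that preserves degrees. -/
@[ext]
structure Hom (M N : FinGrMod 𝒜) where
  toLinearMap : M.carrier →ₗ[A] N.carrier
  map_mem : ∀ (d : ℤ) (m : M.carrier), m ∈ M.deg d → toLinearMap m ∈ N.deg d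

instance : Category (FinGrMod 𝒜) where
  Hom M N := Hom M N
  id M := ⟨LinearMap.id, fun _ _ h => h⟩
  comp f g := ⟨g.toLinearMap ∘ₗ f.toLinearMap, fun d m h => g.map_mem d _ (f.map_mem d m h)⟩

@[ext]
theorem hom_ext {M N : FinGrMod 𝒜} {f g : M ⟶ N} (h : f.toLinearMap = g.toLinearMap) : f = g :=
  Hom.ext h

@[simp]
theorem id_toLinearMap (M : FinGrMod 𝒜) : Hom.toLinearMap (𝟙 M) = LinearMap.id := rfl

@[simp]
theorem comp_toLinearMap {M N L : FinGrMod 𝒜} (f : M ⟶ N) (g : N ⟶ L) :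
    Hom.toLinearMap (f ≫ g) = g.toLinearMap ∘ₗ f.toLinearMap := rfl

/-- The grading shift `M ↦ M⟨k⟩`, where `M⟨k⟩_d = M_{d-k}`. -/
def shift (k : ℤ) : FinGrMod 𝒜 ⥤ FinGrMod 𝒜 where
  obj M :=
    { carrier := M.carrier
      deg := fun d => M.deg (d - k)
      isInternal := by
        have h := M.isInternal
        rw [DirectSum.isInternal_submodule_iff_iSupIndep_and_iSup_eq_top] at h ⊢
        exact ⟨h.1.comp (sub_left_injective (b := k)),
          ((Equiv.subRight k).iSup_comp (g := M.deg)).trans h.2⟩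
      smul_mem := fun i j a m ha hm => by
        rw [add_sub_assoc]
        exact M.smul_mem i (j - k) a m ha hm }
  map f := ⟨f.toLinearMap, fun d m h => f.map_mem (d - k) m h⟩

end Category

section Functors

variable {A B : Type u} [CommRing A] [Algebra K A] [CommRing B] [Algebra K B] [Algebra A B]
  [IsScalarTower K A B] {𝒜 : ℤ → Submodule K A} {ℬ : ℤ → Submodule K B}

/-- Restriction of graded modules along a degree-preserving homomorphism `A → B`. -/
def res (h : ∀ d, ∀ a ∈ 𝒜 d, algebraMap A B a ∈ ℬ d) : FinGrMod ℬ ⥤ FinGrMod 𝒜 where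
  obj M :=
    letI : Module A M.carrier := Module.compHom M.carrier (algebraMap A B)
    haveI : IsScalarTower K A M.carrier := ⟨fun c a m => by
      change algebraMap A B (c • a) • m = c • (algebraMap A B a • m)
      rw [show algebraMap A B (c • a) = c • algebraMap A B a from
        (IsScalarTower.toAlgHom K A B).toLinearMap.map_smul c a, smul_assoc]⟩
    { carrier := M.carrier
      deg := M.deg
      isInternal := M.isInternal
      smul_mem := fun i j a m ha hm => M.smul_mem i j _ m (h i a ha) hm }
  map {M N} f :=
    letI : Module A M.carrier := Module.compHom M.carrier (algebraMap A B)
    letI : Module A N.carrier := Module.compHom N.carrier (algebraMap A B)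
    ⟨{ toFun := f.toLinearMap
       map_add' := f.toLinearMap.map_add
       map_smul' := fun a m => f.toLinearMap.map_smul (algebraMap A B a) m }, f.map_mem⟩

/-- The degree `d` part of `B ⊗[A] N`: the span of all `b ⊗ n` with `deg b + deg n = d`. -/
def tensorDeg (ℬ : ℤ → Submodule K B) (N : FinGrMod 𝒜) (d : ℤ) :
    Submodule K (B ⊗[A] N.carrier) :=
  Submodule.span K {x | ∃ (i j : ℤ) (b : B) (n : N.carrier),
    i + j = d ∧ b ∈ ℬ i ∧ n ∈ N.deg j ∧ x = b ⊗ₜ[A] n}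

theorem tmul_mem_tensorDeg {N : FinGrMod 𝒜} {i j : ℤ} {b : B} {n : N.carrier}
    (hb : b ∈ ℬ i) (hn : n ∈ N.deg j) : b ⊗ₜ[A] n ∈ tensorDeg ℬ N (i + j) :=
  Submodule.subset_span ⟨i, j, b, n, rfl, hb, hn, rfl⟩

theorem tensorDeg_iSup (hℬ : DirectSum.IsInternal ℬ) (N : FinGrMod 𝒜) :
    ⨆ d, tensorDeg ℬ N d = ⊤ := by
  obtain ⟨p, hp, -, -, hps⟩ := exists_proj hℬ
  obtain ⟨q, hq, -, -, hqs⟩ := exists_proj N.isInternal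
  rw [eq_top_iff]
  rintro x -
  induction x with
  | zero => exact zero_mem _
  | add x y hx hy => exact add_mem hx hy
  | tmul b n =>
    obtain ⟨s, hs⟩ := hps b
    obtain ⟨t, ht⟩ := hqs n
    rw [hs, ht, TensorProduct.sum_tmul]
    refine sum_mem fun i _ => ?_
    rw [TensorProduct.tmul_sum]
    refine sum_mem fun j _ => ?_
    exact Submodule.mem_iSup_of_mem (i + j) (tmul_mem_tensorDeg (hp i b) (hq j n))

theorem tensorDeg_isInternal (h𝒜 : DirectSum.IsInternal 𝒜) (hℬ : DirectSum.IsInternal ℬ)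
    (hmul : ∀ i j, ∀ x ∈ ℬ i, ∀ y ∈ ℬ j, x * y ∈ ℬ (i + j))
    (h : ∀ d, ∀ a ∈ 𝒜 d, algebraMap A B a ∈ ℬ d) (N : FinGrMod 𝒜) :
    DirectSum.IsInternal (tensorDeg ℬ N) := by
  classical
  let _ := hℬ.chooseDecomposition
  obtain ⟨r, hrm, -, -, hrs⟩ := exists_proj h𝒜
  obtain ⟨p, hpm, -, -, hps⟩ := exists_proj hℬ
  obtain ⟨q, hqm, hqi, hq0, hqs⟩ := exists_proj N.isInternal
  have hqa : ∀ (e k : ℤ) (a : A) (n : N.carrier), a ∈ 𝒜 k → q e (a • n) = a • q (e - k) n := by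
    intro e k a n ha
    obtain ⟨t, ht⟩ := hqs n
    rw [ht, Finset.smul_sum, map_sum, map_sum, Finset.smul_sum]
    refine Finset.sum_congr rfl fun j _ => ?_
    have hm := N.smul_mem k j a _ ha (hqm j n)
    by_cases he : e = k + j
    · rw [he, hqi _ _ hm, add_sub_cancel_left, hqi _ _ (hqm j n)]
    · rw [hq0 _ _ he _ hm, hq0 _ _ (by omega) _ (hqm j n), smul_zero]
  let g : ℤ → B →+ N.carrier →+ B ⊗[A] N.carrier := fun j => AddMonoidHom.mk'
    (fun b => (TensorProduct.mk A B N.carrier b).toAddMonoidHom.comp (q j).toAddMonoidHom)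
    (fun x y => by ext n; simp)
  let F : ℤ → B →+ N.carrier →+ B ⊗[A] N.carrier := fun d =>
    (DirectSum.toAddMonoid fun i => (g (d - i)).comp (ℬ i).subtype.toAddMonoidHom).comp
      (DirectSum.decomposeAddEquiv ℬ).toAddMonoidHom
  have hF : ∀ (d i : ℤ) (b : B) (n : N.carrier), b ∈ ℬ i → F d b n = b ⊗ₜ q (d - i) n := by
    intro d i b n hb
    lift b to ℬ i using hb
    simp [F, g]
  have hbal : ∀ (d : ℤ) (a : A) (b : B) (n : N.carrier), F d (a • b) n = F d b (a • n) := by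
    intro d a b n
    obtain ⟨s, hs⟩ := hrs a
    obtain ⟨t, ht⟩ := hps b
    rw [hs, ht]
    simp only [Finset.sum_smul, Finset.smul_sum, map_sum, AddMonoidHom.finsetSum_apply]
    rw [Finset.sum_comm]
    refine Finset.sum_congr rfl fun k _ => Finset.sum_congr rfl fun i _ => ?_
    have hm : r k a • p i b ∈ ℬ (k + i) := by
      rw [Algebra.smul_def]
      exact hmul _ _ _ (h k _ (hrm k a)) _ (hpm i b)
    rw [hF d _ _ _ hm, hF d _ _ _ (hpm i b), hqa _ k _ _ (hrm k a), TensorProduct.tmul_smul,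
      TensorProduct.smul_tmul', sub_add_eq_sub_sub_swap]
  have hFs : ∀ (d : ℤ) (c : K) (b : B) (n : N.carrier), F d (c • b) n = c • F d b n := by
    intro d c b n
    obtain ⟨t, ht⟩ := hps b
    rw [ht]
    simp only [Finset.smul_sum, map_sum, AddMonoidHom.finsetSum_apply]
    refine Finset.sum_congr rfl fun i _ => ?_
    rw [hF d _ _ _ ((ℬ i).smul_mem c (hpm i b)), hF d _ _ _ (hpm i b), TensorProduct.smul_tmul']
  let π : ℤ → B ⊗[A] N.carrier →+ B ⊗[A] N.carrier :=
    fun d => TensorProduct.liftAddHom (F d) (hbal d)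
  have hπs : ∀ (d : ℤ) (c : K) (x : B ⊗[A] N.carrier), π d (c • x) = c • π d x := by
    intro d c x
    induction x with
    | zero => simp
    | add x y hx hy => rw [smul_add, map_add, map_add, hx, hy, smul_add]
    | tmul b n =>
      rw [TensorProduct.smul_tmul', TensorProduct.liftAddHom_tmul, TensorProduct.liftAddHom_tmul,
        hFs]
  refine isInternal_of_proj _ π ?_ ?_ (tensorDeg_iSup hℬ N)
  · intro d x hx
    induction hx using Submodule.span_induction with
    | mem x hx =>
      obtain ⟨i, j, b, n, rfl, hb, hn, rfl⟩ := hx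
      rw [TensorProduct.liftAddHom_tmul, hF _ _ _ _ hb, add_sub_cancel_left, hqi _ _ hn]
    | zero => simp
    | add x y _ _ hx hy => rw [map_add, hx, hy]
    | smul c x _ hx => rw [hπs, hx]
  · intro d e hde x hx
    induction hx using Submodule.span_induction with
    | mem x hx =>
      obtain ⟨i, j, b, n, rfl, hb, hn, rfl⟩ := hx
      rw [TensorProduct.liftAddHom_tmul, hF _ _ _ _ hb, hq0 _ j (by omega) _ hn,
        TensorProduct.tmul_zero]
    | zero => simp
    | add x y _ _ hx hy => rw [map_add, hx, hy, add_zero]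
    | smul c x _ hx => rw [hπs, hx, smul_zero]

theorem tensor_finite [Module.Finite A B] (N : FinGrMod 𝒜) :
    Module.Finite K (B ⊗[A] N.carrier) := by
  obtain ⟨k, b, hb⟩ := Module.Finite.exists_fin (R := A) (M := B)
  let f : (Fin k → N.carrier) →ₗ[K] B ⊗[A] N.carrier :=
    { toFun := fun v => ∑ i, b i ⊗ₜ v i
      map_add' := fun v w => by simp [TensorProduct.tmul_add, Finset.sum_add_distrib]
      map_smul' := fun c v => by simp [Finset.smul_sum] }
  refine Module.Finite.of_surjective f fun x => ?_
  induction x with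
  | zero => exact ⟨0, map_zero f⟩
  | add x y hx hy =>
    obtain ⟨v, rfl⟩ := hx
    obtain ⟨w, rfl⟩ := hy
    exact ⟨v + w, map_add f v w⟩
  | tmul x n =>
    have hx : x ∈ Submodule.span A (Set.range b) := hb ▸ Submodule.mem_top
    obtain ⟨c, rfl⟩ := (Submodule.mem_span_range_iff_exists_fun A).1 hx
    refine ⟨fun i => c i • n, ?_⟩
    simp [f, TensorProduct.sum_tmul, TensorProduct.smul_tmul']

/-- Induction `N ↦ B ⊗[A] N` of finite-dimensional graded modules along a degree-preserving
homomorphism `A → B` that makes `B` a finite `A`-module. -/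
noncomputable def ind [Module.Finite A B] (h𝒜 : DirectSum.IsInternal 𝒜)
    (hℬ : DirectSum.IsInternal ℬ)
    (hmul : ∀ i j, ∀ x ∈ ℬ i, ∀ y ∈ ℬ j, x * y ∈ ℬ (i + j))
    (h : ∀ d, ∀ a ∈ 𝒜 d, algebraMap A B a ∈ ℬ d) : FinGrMod 𝒜 ⥤ FinGrMod ℬ where
  obj N :=
    haveI := tensor_finite (B := B) N
    { carrier := B ⊗[A] N.carrier
      deg := tensorDeg ℬ N
      isInternal := tensorDeg_isInternal h𝒜 hℬ hmul h N
      smul_mem := fun i j a m ha hm => by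
        induction hm using Submodule.span_induction with
        | mem x hx =>
          obtain ⟨k, l, b, n, rfl, hb, hn, rfl⟩ := hx
          rw [TensorProduct.smul_tmul', ← add_assoc]
          exact tmul_mem_tensorDeg (hmul _ _ _ ha _ hb) hn
        | zero => simp
        | add x y _ _ hx hy => rw [smul_add]; exact add_mem hx hy
        | smul c x _ hx => rw [smul_comm]; exact Submodule.smul_mem _ c hx }
  map f := ⟨f.toLinearMap.baseChange B, fun d m hm => by
    induction hm using Submodule.span_induction with
    | mem x hx =>
      obtain ⟨k, l, b, n, rfl, hb, hn, rfl⟩ := hx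
      rw [LinearMap.baseChange_tmul]
      exact tmul_mem_tensorDeg hb (f.map_mem _ _ hn)
    | zero => simp
    | add x y _ _ hx hy => rw [map_add]; exact add_mem hx hy
    | smul c x _ hx => 
      rw [LinearMap.map_smul_of_tower]; exact Submodule.smul_mem _ c hx⟩
  map_id N := by ext; simp
  map_comp f g := by ext; simp

end Functors

section Graded

variable {A B : Type u} [CommRing A] [Algebra K A] [CommRing B] [Algebra K B]
  {𝒜 : ℤ → Submodule K A} {ℬ : ℤ → Submodule K B}

/-- A functor between categories of graded modules is graded if it commutes with all grading
shifts up to natural isomorphism. -/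
def IsGradedFunctor (F : FinGrMod 𝒜 ⥤ FinGrMod ℬ) : Prop :=
  ∀ k : ℤ, Nonempty (shift k ⋙ F ≅ F ⋙ shift k)

end Graded

end FinGrMod
end GradedRep

/-! ### The symmetric algebra and the coinvariant algebra -/

namespace Coinvariant

open GradedRep

section Sym

variable (K : Type v) [Field K] (V : Type u) [AddCommGroup V] [Module K V]

/-- The grading of `S(V)` in which the elements of `V` have degree `2`: the degree `d` part is
`S_j(V)` if `d = 2 * j` with `j` a natural number, and zero for all other `d`. -/
def symDeg (d : ℤ) : Submodule K (SymmetricAlgebra K V) :=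
  ⨆ (j : ℕ) (_ : d = 2 * (j : ℤ)), LinearMap.range (SymmetricAlgebra.ι K V) ^ j

variable {K V}

theorem mem_symDeg_iff {d : ℤ} {f : SymmetricAlgebra K V} :
    f ∈ symDeg K V d ↔
      f = 0 ∨ ∃ j : ℕ, d = 2 * (j : ℤ) ∧ f ∈ LinearMap.range (SymmetricAlgebra.ι K V) ^ j := by
  constructor
  · intro h
    by_cases hd : ∃ j : ℕ, d = 2 * (j : ℤ)
    · obtain ⟨j, hj⟩ := hd
      refine Or.inr ⟨j, hj, ?_⟩
      refine (iSup₂_le fun k hk => ?_ : symDeg K V d ≤ _) h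
      obtain rfl : k = j := by omega
      exact le_rfl
    · left
      have : symDeg K V d ≤ ⊥ := iSup₂_le fun k hk => (hd ⟨k, hk⟩).elim
      simpa using this h
  · rintro (rfl | ⟨j, hj, h⟩)
    · exact zero_mem _
    · exact Submodule.mem_iSup_of_mem j (Submodule.mem_iSup_of_mem hj h)

theorem pow_le_symDeg (j : ℕ) :
    LinearMap.range (SymmetricAlgebra.ι K V) ^ j ≤ symDeg K V (2 * (j : ℤ)) :=
  fun _ h => mem_symDeg_iff.2 (Or.inr ⟨j, rfl, h⟩)

theorem ι_mem_symDeg (x : V) : SymmetricAlgebra.ι K V x ∈ symDeg K V 2 := by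
  have := pow_le_symDeg (K := K) (V := V) 1
  simp only [pow_one, Nat.cast_one, mul_one] at this
  exact this ⟨x, rfl⟩

theorem one_mem_symDeg : (1 : SymmetricAlgebra K V) ∈ symDeg K V 0 := by
  refine mem_symDeg_iff.2 (Or.inr ⟨0, by simp, ?_⟩)
  rw [pow_zero]
  exact Submodule.one_le.mp le_rfl

theorem mul_mem_symDeg (i j : ℤ) (x : SymmetricAlgebra K V) (hx : x ∈ symDeg K V i)
    (y : SymmetricAlgebra K V) (hy : y ∈ symDeg K V j) : x * y ∈ symDeg K V (i + j) := by
  rcases mem_symDeg_iff.1 hx with rfl | ⟨k, rfl, hx'⟩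
  · simp
  rcases mem_symDeg_iff.1 hy with rfl | ⟨l, rfl, hy'⟩
  · simp
  refine mem_symDeg_iff.2 (Or.inr ⟨k + l, by push_cast; ring, ?_⟩)
  rw [pow_add]
  exact Submodule.mul_mem_mul hx' hy'

open Polynomial in
theorem symDeg_isInternal : DirectSum.IsInternal (symDeg K V) := by
  let Φ : SymmetricAlgebra K V →ₐ[K] (SymmetricAlgebra K V)[X] :=
    SymmetricAlgebra.lift
      ((LinearMap.mulRight K (X ^ 2 : (SymmetricAlgebra K V)[X])) ∘ₗ
        (CAlgHom : SymmetricAlgebra K V →ₐ[K] (SymmetricAlgebra K V)[X]).toLinearMap ∘ₗ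
          SymmetricAlgebra.ι K V)
  have hΦ : ∀ (j : ℕ), ∀ f ∈ LinearMap.range (SymmetricAlgebra.ι K V) ^ j,
      Φ f = C f * X ^ (2 * j) := by
    intro j f hf
    induction hf using Submodule.pow_induction_on_left' with
    | algebraMap r =>
      rw [AlgHom.commutes, mul_zero, pow_zero, mul_one]
      rfl
    | add x y i _ _ hx hy => rw [map_add, hx, hy, C_add, add_mul]
    | mem_mul m hm i x _ hx =>
      obtain ⟨m, rfl⟩ := hm
      have hm : Φ (SymmetricAlgebra.ι K V m) = C (SymmetricAlgebra.ι K V m) * X ^ 2 :=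
        SymmetricAlgebra.lift_ι_apply _ m
      rw [map_mul, hm, hx, C_mul, Nat.succ_eq_add_one]
      ring
  refine isInternal_of_proj _ (fun d => if 0 ≤ d then
    ((lcoeff (SymmetricAlgebra K V) d.toNat).toAddMonoidHom.comp
      (Φ : SymmetricAlgebra K V →+ (SymmetricAlgebra K V)[X])) else 0) ?_ ?_ ?_
  · intro d x hx
    rcases mem_symDeg_iff.1 hx with rfl | ⟨k, rfl, hx'⟩
    · exact map_zero _
    · rw [if_pos (by omega)]
      change (Φ x).coeff _ = x
      rw [hΦ k x hx', coeff_C_mul, coeff_X_pow, if_pos (by omega), mul_one]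
  · intro d e hde x hx
    rcases mem_symDeg_iff.1 hx with rfl | ⟨k, rfl, hx'⟩
    · exact map_zero _
    · split_ifs with hd
      · change (Φ x).coeff _ = 0
        rw [hΦ k x hx', coeff_C_mul, coeff_X_pow, if_neg (by omega), mul_zero]
      · rfl
  · rw [eq_top_iff]
    rintro x -
    have hmul : ∀ x ∈ ⨆ d, symDeg K V d, ∀ y ∈ ⨆ d, symDeg K V d,
        x * y ∈ ⨆ d, symDeg K V d := by
      intro x hx y hy
      induction hx using Submodule.iSup_induction' with
      | mem i x hx =>
        induction hy using Submodule.iSup_induction' with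
        | mem j y hy => exact Submodule.mem_iSup_of_mem (i + j) (mul_mem_symDeg i j x hx y hy)
        | zero => simp
        | add y z _ _ hy hz => rw [mul_add]; exact add_mem hy hz
      | zero => simp
      | add x z _ _ hx hz => rw [add_mul]; exact add_mem hx hz
    induction x using SymmetricAlgebra.induction with
    | algebraMap r =>
      rw [Algebra.algebraMap_eq_smul_one]
      exact Submodule.mem_iSup_of_mem 0 (Submodule.smul_mem _ r one_mem_symDeg)
    | ι x => exact Submodule.mem_iSup_of_mem 2 (ι_mem_symDeg x)
    | mul x y hx hy => exact hmul x hx y hy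
    | add x y hx hy => exact add_mem hx hy

/-- An algebra homomorphism `S(V) → S(V)` induced by a linear map `V → V` preserves degrees. -/
theorem lift_mem_symDeg (f : V →ₗ[K] V) (d : ℤ) (x : SymmetricAlgebra K V)
    (hx : x ∈ symDeg K V d) :
    SymmetricAlgebra.lift (SymmetricAlgebra.ι K V ∘ₗ f) x ∈ symDeg K V d := by
  rcases mem_symDeg_iff.1 hx with rfl | ⟨k, rfl, hx'⟩
  · rw [map_zero]; exact zero_mem _
  · refine pow_le_symDeg k ?_
    have h1 := Submodule.mem_map_of_mem
      (f := (SymmetricAlgebra.lift (SymmetricAlgebra.ι K V ∘ₗ f)).toLinearMap) hx'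
    rw [Submodule.map_pow] at h1
    have h2 : (LinearMap.range (SymmetricAlgebra.ι K V)).map
        (SymmetricAlgebra.lift (SymmetricAlgebra.ι K V ∘ₗ f)).toLinearMap ≤
          LinearMap.range (SymmetricAlgebra.ι K V) := by
      rintro _ ⟨_, ⟨v, rfl⟩, rfl⟩
      exact ⟨f v, (SymmetricAlgebra.lift_ι_apply (SymmetricAlgebra.ι K V ∘ₗ f) v).symm⟩
    exact (pow_le_pow_left' h2 k : _ ≤ _) h1

end Sym

/-- A finitely generated commutative algebra is finite over its subalgebra of invariants under a
finite group. -/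
theorem finite_of_invariants {K : Type v} [Field K] {C : Type u} [CommRing C] [Algebra K C]
    [Algebra.FiniteType K C] {G : Type*} [Group G] [Finite G] (ρ : G →* (C →ₐ[K] C))
    (S : Subalgebra K C) (hS : ∀ x, x ∈ S ↔ ∀ g, ρ g x = x) : Module.Finite S C := by
  have h3 : Algebra.FiniteType S C := Algebra.FiniteType.of_restrictScalars_finiteType K _ _
  let act : MulSemiringAction G C :=
    { smul := fun w x => ρ w x
      one_smul := fun x => DFunLike.congr_fun (map_one ρ) x
      mul_smul := fun w w' x => DFunLike.congr_fun (map_mul ρ w w') x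
      smul_zero := fun w => map_zero (ρ w)
      smul_add := fun w => map_add (ρ w)
      smul_one := fun w => map_one (ρ w)
      smul_mul := fun w => map_mul (ρ w) }
  have h6 : SMulCommClass G S C := ⟨fun w a x => by
    change ρ w (a * x) = a * ρ w x
    rw [map_mul, (hS a).1 a.2 w]⟩
  have h4 : Algebra.IsInvariant S C G := ⟨fun x hx => ⟨⟨x, (hS x).2 hx⟩, rfl⟩⟩
  have h5 : Algebra.IsIntegral S C := Algebra.IsInvariant.isIntegral _ _ G
  exact Algebra.IsIntegral.finite

section Weyl

variable {ι : Type*} {V : Type u} {V' : Type*} [AddCommGroup V] [Module ℂ V] [AddCommGroup V']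
  [Module ℂ V'] (P : RootPairing ι ℂ V V')

/-- The action of the Weyl group on the symmetric algebra `S(V)` of the root space `V`. -/
noncomputable def symAct : P.weylGroup →* (SymmetricAlgebra ℂ V →ₐ[ℂ] SymmetricAlgebra ℂ V) where
  toFun w := SymmetricAlgebra.lift (SymmetricAlgebra.ι ℂ V ∘ₗ P.weylGroupRootRep w)
  map_one' := by
    ext x
    simp
  map_mul' w w' := by
    ext x
    simp

/-- The ideal `I_W` of `S(V)` generated by the homogeneous `W`-invariants of positive degree. -/
noncomputable def coinvIdeal : Ideal (SymmetricAlgebra ℂ V) :=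
  Ideal.span {f | (∃ d : ℤ, 0 < d ∧ f ∈ symDeg ℂ V d) ∧ ∀ w, symAct P w f = f}

/-- The coinvariant algebra `C = S(V) / I_W`. -/
abbrev CoinvAlg : Type u := SymmetricAlgebra ℂ V ⧸ coinvIdeal P

theorem coinvIdeal_le_comap (w : P.weylGroup) :
    coinvIdeal P ≤ (coinvIdeal P).comap (symAct P w) := by
  refine Ideal.span_le.2 fun f hf => ?_
  change symAct P w f ∈ coinvIdeal P
  rw [hf.2 w]
  exact Ideal.subset_span hf

/-- The induced action of the Weyl group on the coinvariant algebra. -/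
noncomputable def coinvAct : P.weylGroup →* (CoinvAlg P →ₐ[ℂ] CoinvAlg P) where
  toFun w := Ideal.quotientMapₐ (coinvIdeal P) (symAct P w) (coinvIdeal_le_comap P w)
  map_one' := by
    refine Ideal.Quotient.algHom_ext _ ?_
    ext x
    simp
  map_mul' w w' := by
    refine Ideal.Quotient.algHom_ext _ ?_
    ext x
    simp

/-- The grading of the coinvariant algebra, induced by the grading of `S(V)` with `deg V = 2`. -/
noncomputable def coinvDeg (d : ℤ) : Submodule ℂ (CoinvAlg P) :=
  (symDeg ℂ V d).map (Ideal.Quotient.mkₐ ℂ (coinvIdeal P)).toLinearMap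

theorem coinvDeg_mul (i j : ℤ) (x : CoinvAlg P) (hx : x ∈ coinvDeg P i) (y : CoinvAlg P)
    (hy : y ∈ coinvDeg P j) : x * y ∈ coinvDeg P (i + j) := by
  obtain ⟨x, hx, rfl⟩ := hx
  obtain ⟨y, hy, rfl⟩ := hy
  exact ⟨x * y, mul_mem_symDeg i j x hx y hy, map_mul (Ideal.Quotient.mkₐ ℂ (coinvIdeal P)) x y⟩

theorem coinvAct_mem_coinvDeg (w : P.weylGroup) (d : ℤ) (x : CoinvAlg P)
    (hx : x ∈ coinvDeg P d) : coinvAct P w x ∈ coinvDeg P d := by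
  obtain ⟨x, hx, rfl⟩ := hx
  exact ⟨symAct P w x, lift_mem_symDeg _ d x hx, rfl⟩

theorem coinvDeg_isInternal : DirectSum.IsInternal (coinvDeg P) := by
  obtain ⟨p, hpm, hpi, hp0, hps⟩ := exists_proj (symDeg_isInternal (K := ℂ) (V := V))
  have hpx : ∀ (d k : ℤ) (a f : SymmetricAlgebra ℂ V), f ∈ symDeg ℂ V k →
      p d (a * f) = p (d - k) a * f := by
    intro d k a f hf
    obtain ⟨s, hs⟩ := hps a
    rw [hs, Finset.sum_mul, map_sum, map_sum, Finset.sum_mul]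
    refine Finset.sum_congr rfl fun i _ => ?_
    have hm := mul_mem_symDeg i k _ (hpm i a) f hf
    by_cases hd : d = i + k
    · rw [hd, hpi _ _ hm, add_sub_cancel_right, hpi _ _ (hpm i a)]
    · rw [hp0 _ _ hd _ hm, hp0 _ _ (by omega) _ (hpm i a), zero_mul]
  have hpI : ∀ x ∈ coinvIdeal P, ∀ d : ℤ, p d x ∈ coinvIdeal P := by
    intro x hx
    induction hx using Submodule.span_induction with
    | mem f hf =>
      intro d
      obtain ⟨⟨k, hk, hfk⟩, hf'⟩ := hf
      have := hpx d k 1 f hfk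
      rw [one_mul] at this
      rw [this]
      exact Ideal.mul_mem_left _ _ (Ideal.subset_span ⟨⟨k, hk, hfk⟩, hf'⟩)
    | zero => intro d; rw [map_zero]; exact zero_mem _
    | add x y _ _ hx hy => intro d; rw [map_add]; exact add_mem (hx d) (hy d)
    | smul a x _ hx =>
      intro d
      obtain ⟨s, hs⟩ := hps a
      rw [hs, Finset.sum_smul, map_sum]
      refine sum_mem fun i _ => ?_
      rw [smul_eq_mul, mul_comm, hpx d i x _ (hpm i a)]
      exact Ideal.mul_mem_right _ _ (hx _)
  let q : ℤ → CoinvAlg P →+ CoinvAlg P := fun d =>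
    QuotientAddGroup.map _ _ (p d).toAddMonoidHom fun x hx => hpI x hx d
  have hq : ∀ d x, q d (Ideal.Quotient.mk _ x) = Ideal.Quotient.mk _ (p d x) := fun _ _ => rfl
  refine isInternal_of_proj _ q ?_ ?_ ?_
  · rintro d _ ⟨x, hx, rfl⟩
    change q d (Ideal.Quotient.mk _ x) = _
    rw [hq, hpi d x hx]
    rfl
  · rintro d e hde _ ⟨x, hx, rfl⟩
    change q d (Ideal.Quotient.mk _ x) = _
    rw [hq, hp0 d e hde x hx, map_zero]
  · rw [eq_top_iff]
    rintro x -
    obtain ⟨x, rfl⟩ := Ideal.Quotient.mk_surjective x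
    obtain ⟨s, hs⟩ := hps x
    rw [hs, map_sum]
    exact sum_mem fun i _ => Submodule.mem_iSup_of_mem i ⟨p i x, hpm i x, rfl⟩

variable {P}

/-- The simple reflection attached to a simple root. -/
noncomputable def simpleReflection (b : P.Base) (i : b.support) : P.weylGroup :=
  RootPairing.weylGroup.ofIdx P i

/-- The parabolic subgroup `W_J` generated by the simple reflections in `J`. -/
noncomputable def parabolic (b : P.Base) (J : Set b.support) : Subgroup P.weylGroup :=
  Subgroup.closure (simpleReflection b '' J)

/-- The subalgebra `C^J` of `W_J`-invariants in the coinvariant algebra. -/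
noncomputable def coinvInv (b : P.Base) (J : Set b.support) : Subalgebra ℂ (CoinvAlg P) where
  carrier := {x | ∀ w ∈ parabolic b J, coinvAct P w x = x}
  mul_mem' hx hy w hw := by rw [map_mul, hx w hw, hy w hw]
  add_mem' hx hy w hw := by rw [map_add, hx w hw, hy w hw]
  algebraMap_mem' c w _ := AlgHom.commutes _ c

/-- The grading of `C^J` inherited from `C`. -/
noncomputable def coinvInvDeg (b : P.Base) (J : Set b.support) (d : ℤ) : Submodule ℂ (coinvInv b J) :=
  (coinvDeg P d).comap (coinvInv b J).val.toLinearMap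

theorem coinvInvDeg_isInternal (b : P.Base) (J : Set b.support) :
    DirectSum.IsInternal (coinvInvDeg b J) := by
  obtain ⟨p, hpm, hpi, hp0, hps⟩ := exists_proj (coinvDeg_isInternal P)
  have hpw : ∀ d w x, p d (coinvAct P w x) = coinvAct P w (p d x) := by
    intro d w x
    obtain ⟨s, hs⟩ := hps x
    rw [hs]
    simp only [map_sum]
    refine Finset.sum_congr rfl fun i _ => ?_
    have hm := coinvAct_mem_coinvDeg P w i _ (hpm i x)
    by_cases hd : d = i
    · rw [hd, hpi _ _ hm, hpi _ _ (hpm i x)]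
    · rw [hp0 _ _ hd _ hm, hp0 _ _ hd _ (hpm i x), map_zero]
  have hpJ : ∀ d, ∀ x ∈ coinvInv b J, p d x ∈ coinvInv b J := fun d x hx w hw => by
    rw [← hpw, hx w hw]
  refine isInternal_of_proj _ (fun d => ((p d).restrict
    (p := Subalgebra.toSubmodule (coinvInv b J)) (q := Subalgebra.toSubmodule (coinvInv b J))
    (hpJ d)).toAddMonoidHom) ?_ ?_ ?_
  · intro d x hx
    exact Subtype.ext (hpi d x hx)
  · intro d e hde x hx
    exact Subtype.ext (hp0 d e hde x hx)
  · rw [eq_top_iff]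
    rintro x -
    obtain ⟨s, hs⟩ := hps x
    have : x = ∑ i ∈ s, (⟨p i x, hpJ i x x.2⟩ : coinvInv b J) := by
      apply Subtype.ext
      rw [AddSubmonoidClass.coe_finsetSum]
      exact hs
    rw [this]
    exact sum_mem fun i _ => Submodule.mem_iSup_of_mem i (hpm i x)

theorem algebraMap_mem_coinvDeg (b : P.Base) (J : Set b.support) (d : ℤ) (a : coinvInv b J)
    (ha : a ∈ coinvInvDeg b J d) : algebraMap (coinvInv b J) (CoinvAlg P) a ∈ coinvDeg P d := ha

/-! ### Length, reduced expressions, Demazure operators -/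

/-- `l` is an expression of `w` as a product of simple reflections. -/
def IsExpr (b : P.Base) (w : P.weylGroup) (l : List b.support) : Prop :=
  (l.map (simpleReflection b)).prod = w

/-- The length of `w`: the smallest number of factors in an expression of `w` as a product of
simple reflections. -/
noncomputable def weylLength (b : P.Base) (w : P.weylGroup) : ℕ :=
  sInf {n | ∃ l, IsExpr b w l ∧ l.length = n}

/-- `l` is a reduced expression of `w`. -/
def IsReducedExpr (b : P.Base) (w : P.weylGroup) (l : List b.support) : Prop :=
  IsExpr b w l ∧ l.length = weylLength b w

/-- Every element of the Weyl group has a reduced expression. -/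
theorem exists_isReducedExpr [Finite ι] [P.IsCrystallographic] [P.IsReduced] (b : P.Base)
    (w : P.weylGroup) : ∃ l, IsReducedExpr b w l := by
  have hmul : ∀ i j : ι, RootPairing.weylGroup.ofIdx P (P.reflectionPerm j i) =
      RootPairing.weylGroup.ofIdx P j * RootPairing.weylGroup.ofIdx P i *
        RootPairing.weylGroup.ofIdx P j := by
    intro i j
    refine Subtype.ext (RootPairing.Equiv.weightHom_injective P ?_)
    refine LinearEquiv.ext fun x => ?_
    change P.reflection (P.reflectionPerm j i) x =
      P.reflection j (P.reflection i (P.reflection j x))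
    rw [RootPairing.reflection_reflectionPerm]
    rfl
  have hrefl : ∀ i : ι, ∃ l, IsExpr b (RootPairing.weylGroup.ofIdx P i) l := by
    intro i
    refine b.induction_reflect (p := fun i => ∃ l, IsExpr b (RootPairing.weylGroup.ofIdx P i) l)
      i ?_ ?_ ?_
    · rintro i ⟨l, hl⟩
      refine ⟨l ++ l ++ l, ?_⟩
      rw [IsExpr, hmul, List.map_append, List.map_append, List.prod_append, List.prod_append, hl]
    · intro i hi
      refine ⟨[⟨i, hi⟩], ?_⟩
      simp [IsExpr, simpleReflection]
    · rintro i j ⟨l, hl⟩ hj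
      refine ⟨[⟨j, hj⟩] ++ l ++ [⟨j, hj⟩], ?_⟩
      rw [IsExpr, hmul, List.map_append, List.map_append, List.prod_append, List.prod_append, hl]
      simp [simpleReflection]
  have hex : ∃ l, IsExpr b w l := by
    obtain ⟨w, hw⟩ := w
    induction hw using RootPairing.weylGroup.induction with
    | mem i => exact hrefl i
    | one => exact ⟨[], rfl⟩
    | mul x y hx hy ihx ihy =>
      obtain ⟨l, hl⟩ := ihx
      obtain ⟨l', hl'⟩ := ihy
      refine ⟨l ++ l', ?_⟩
      rw [IsExpr, List.map_append, List.prod_append, hl, hl']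
      rfl
  obtain ⟨l, hl⟩ := hex
  exact Nat.sInf_mem (s := {n | ∃ l, IsExpr b w l ∧ l.length = n}) ⟨l.length, l, hl, rfl⟩

/-- `f - s_i f` is divisible by the root `α_i` in `S(V)`. -/
theorem exists_demazure (i : ι) (f : SymmetricAlgebra ℂ V) :
    ∃ g, f - symAct P (RootPairing.weylGroup.ofIdx P i) f =
      SymmetricAlgebra.ι ℂ V (P.root i) * g := by
  set s := symAct P (RootPairing.weylGroup.ofIdx P i) with hs
  induction f using SymmetricAlgebra.induction with
  | algebraMap r => exact ⟨0, by rw [AlgHom.commutes, sub_self, mul_zero]⟩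
  | ι x =>
    refine ⟨algebraMap ℂ _ (P.toLinearMap x (P.coroot i)), ?_⟩
    have : s (SymmetricAlgebra.ι ℂ V x) = SymmetricAlgebra.ι ℂ V (P.reflection i x) :=
      SymmetricAlgebra.lift_ι_apply _ x
    rw [this, RootPairing.reflection_apply, map_sub, map_smul, sub_sub_cancel, Algebra.smul_def,
      mul_comm]
    rfl
  | mul f g hf hg =>
    obtain ⟨f', hf⟩ := hf
    obtain ⟨g', hg⟩ := hg
    refine ⟨f' * g + s f * g', ?_⟩
    rw [map_mul]
    linear_combination g * hf + s f * hg
  | add f g hf hg =>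
    obtain ⟨f', hf⟩ := hf
    obtain ⟨g', hg⟩ := hg
    refine ⟨f' + g', ?_⟩
    rw [map_add]
    linear_combination hf + hg

/-- The Demazure operator `Δ_s f = (f - s f) / α` of the simple reflection `s` of a simple
root `α`. The quotient is unique because `S(V)` is a domain and `α ≠ 0`. -/
noncomputable def demazure (b : P.Base) (i : b.support) (f : SymmetricAlgebra ℂ V) :
    SymmetricAlgebra ℂ V :=
  (exists_demazure (P := P) i f).choose

theorem demazure_spec (b : P.Base) (i : b.support) (f : SymmetricAlgebra ℂ V) :
    f - symAct P (simpleReflection b i) f =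
      SymmetricAlgebra.ι ℂ V (P.root i) * demazure b i f :=
  (exists_demazure (P := P) i f).choose_spec

/-- The composite `Δ_{s₁} ∘ ⋯ ∘ Δ_{sₖ}` attached to a list `[s₁, …, sₖ]` of simple reflections. If
the list is a reduced expression of `w`, this is the Demazure operator `Δ_w`. -/
noncomputable def demazureWord (b : P.Base) (l : List b.support) (f : SymmetricAlgebra ℂ V) :
    SymmetricAlgebra ℂ V :=
  l.foldr (demazure b) f

/-- The product `μ_J` of the positive roots in the root subsystem `Φ_J` generated by `J`. -/
noncomputable def rootProd (b : P.Base) (J : Set b.support) : SymmetricAlgebra ℂ V :=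
  ∏ᶠ i ∈ {i : ι | b.IsPos i ∧
    P.root i ∈ Submodule.span ℤ ((fun j : b.support => P.root j) '' J)},
    SymmetricAlgebra.ι ℂ V (P.root i)

section Finite

variable [Finite ι] [P.IsRootSystem]

instance weylGroup_finite : Finite P.weylGroup := by
  have : Function.Injective fun w : P.weylGroup => fun i => w • P.root i := by
    intro w w' h
    refine Subtype.ext (RootPairing.Equiv.weightHom_injective P ?_)
    refine LinearEquiv.toLinearMap_injective ?_
    refine LinearMap.ext_on_range (RootPairing.IsRootSystem.span_root_eq_top (P := P)) fun i => ?_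
    exact congrFun h i
  have h2 : Function.Injective fun w : P.weylGroup => fun i => P.weylGroupToPerm w i := by
    intro w w' h
    refine this (funext fun i => ?_)
    change w • P.root i = w' • P.root i
    rw [RootPairing.weylGroup_apply_root, RootPairing.weylGroup_apply_root]
    exact congrArg P.root (congrFun h i)
  exact Finite.of_injective _ h2

theorem exists_longest (b : P.Base) (J : Set b.support) :
    ∃ w ∈ parabolic b J, ∀ u ∈ parabolic b J, weylLength b u ≤ weylLength b w :=
  Set.exists_max_image _ (weylLength b) (Set.toFinite _) ⟨1, one_mem _⟩

/-- The longest element `w_J` of the parabolic subgroup `W_J`. -/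
noncomputable def longest (b : P.Base) (J : Set b.support) : P.weylGroup :=
  (exists_longest b J).choose

instance coinvAlg_finite (b : P.Base) (J : Set b.support) :
    Module.Finite (coinvInv b J) (CoinvAlg P) := by
  have hV : FiniteDimensional ℂ V :=
    ⟨⟨(Set.finite_range P.root).toFinset, by
      rw [Set.Finite.coe_toFinset]; exact RootPairing.IsRootSystem.span_root_eq_top⟩⟩
  have h1 : Algebra.FiniteType ℂ (SymmetricAlgebra ℂ V) :=
    Algebra.FiniteType.equiv inferInstance
      (SymmetricAlgebra.equivMvPolynomial (Module.finBasis ℂ V)).symm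
  have h2 : Algebra.FiniteType ℂ (CoinvAlg P) :=
    Algebra.FiniteType.of_surjective (Ideal.Quotient.mkₐ ℂ (coinvIdeal P))
      Ideal.Quotient.mk_surjective
  exact finite_of_invariants ((coinvAct P).comp (parabolic b J).subtype) _
    fun x => ⟨fun hx w => hx w.1 w.2, fun hx w hw => hx ⟨w, hw⟩⟩

variable (b : P.Base) (J : Set b.support)

/-- The graded restriction functor from `C`-modules to `C^J`-modules. -/
noncomputable def resC : FinGrMod (coinvDeg P) ⥤ FinGrMod (coinvInvDeg b J) :=
  FinGrMod.res (algebraMap_mem_coinvDeg b J)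

/-- The graded induction functor `C ⊗_{C^J} -` from `C^J`-modules to `C`-modules. -/
noncomputable def indC : FinGrMod (coinvInvDeg b J) ⥤ FinGrMod (coinvDeg P) :=
  FinGrMod.ind (coinvInvDeg_isInternal b J) (coinvDeg_isInternal P) (coinvDeg_mul P)
    (algebraMap_mem_coinvDeg b J)

end Finite

end Weyl

end Coinvariant

open GradedRep Coinvariant

/-! The theorem says that $C$ is a graded Frobenius extension of $C^J$. The Frobenius form is $D =
\Delta_{w_J} : C \to C^J$ (`coinvTop`), which lowers degrees by $2\ell(w_J)$. Put $x_w =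
\Delta_w(\mu_J)$. The essential point is the existence of homogeneous elements $y_w$, $w \in W_J$,
with $D(y_u x_w) = \delta_{uw}$ and $f = \sum_w D(y_w f)\,x_w$ for all $f$
(`exists_coinv_dual_basis`). These identities make $(x_w)$ a basis (`exists_basis_of_dual`). They
also turn $g \mapsto (m \mapsto \sum_w x_w \otimes g(y_w m))$ and composition with $D \otimes
\mathrm{id}$ into mutually inverse bijections, which is the adjunction between res and the shifted
ind (`nonempty_res_adj_ind`). The pair (ind, res) is the usual extension of scalars.

The dual basis comes from the Gram matrix of $D$. Since $\Delta_{w_J}$ factors through every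
$\Delta_s$ with $s \in J$, the operators $\Delta_s$ are self-adjoint for the form
$\Delta_{w_J}(fg)$, so $D(\Delta_u\mu_J \cdot \Delta_w\mu_J) = \Delta_{w_J}(\mu_J \cdot
\Delta_{u^{-1}}\Delta_w\mu_J)$. When $\ell(u)+\ell(w) > \ell(w_J)$ this is zero. When equality holds
it is zero unless $u^{-1}w = w_J$, and then it is a nonzero constant. With rows indexed by $v$
through $u = vw_J$ the matrix is block triangular with scalar diagonal blocks (`isUnit_gram`).
Spanning follows because the $x_w$ separate points (`eq_zero_of_coinvTop`): a descending induction
on the length of $l$ shows that each $\Delta_l x$ is $W_J$-invariant, hence is detected by pairing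
$x$ with some $\Delta_u\mu_J$. Neither the dimension of $C$ nor the freeness of $S(V)$ over its
invariants enters.

Two facts on Demazure operators carry this. First, a composite of the $\Delta_s$ depends only on the
length and the product of the word, and vanishes on non-reduced words (`demazureWord_congr`,
`demazureWord_eq_zero`). This is proved without braid relations: commuting a word past a linear form
(`demazureWord_ι_mul`) produces a sum over letter deletions, and since coroots are odd this sum
collapses to one over the inversions of the product (`sum_deletions`), where the word is no longer
visible. Secondly, $\Delta_{w_J}(\mu_J)$ is a nonzero constant (`exists_demazureTop_rootProd`): the
same collapse, with positive coefficients, gives $\Delta_{w_J}(x^{\ell(w_J)}) \neq 0$ for a regular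
dominant weight $x$, and antisymmetrising that power gives a scalar multiple of $\mu_J$. -/

namespace Coinvariant

/-! ### Words, letter deletions and inversion sets in the Weyl group. -/

section Roots

variable {ι : Type*} {V : Type u} {V' : Type*} [AddCommGroup V] [Module ℂ V] [AddCommGroup V']
  [Module ℂ V'] (P : RootPairing ι ℂ V V')

/-- The index of the root `-α_i`. -/
def opp (i : ι) : ι := P.reflectionPerm i i

theorem root_opp (i : ι) : P.root (opp P i) = - P.root i := by
  rw [opp, RootPairing.root_reflectionPerm, RootPairing.reflection_apply_self]

theorem coroot_opp (i : ι) : P.coroot (opp P i) = - P.coroot i := by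
  rw [opp, RootPairing.coroot_reflectionPerm, RootPairing.coreflection_apply_self]

@[simp]
theorem opp_opp (i : ι) : opp P (opp P i) = i :=
  P.root.injective (by rw [root_opp, root_opp, neg_neg])

variable {P}

theorem smul_root (w : P.weylGroup) (i : ι) :
    w • P.root i = P.root (P.weylGroupToPerm w i) :=
  RootPairing.weylGroup_apply_root P w i

theorem perm_opp (w : P.weylGroup) (i : ι) :
    P.weylGroupToPerm w (opp P i) = opp P (P.weylGroupToPerm w i) := by
  apply P.root.injective
  rw [← smul_root, root_opp, root_opp, smul_neg, smul_root]

theorem perm_mul (w w' : P.weylGroup) (i : ι) :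
    P.weylGroupToPerm (w * w') i = P.weylGroupToPerm w (P.weylGroupToPerm w' i) := by
  rw [map_mul]; rfl

theorem perm_ofIdx (i j : ι) :
    P.weylGroupToPerm (RootPairing.weylGroup.ofIdx P i) j = P.reflectionPerm i j := by
  apply P.root.injective
  rw [← smul_root, RootPairing.root_reflectionPerm]
  rfl

theorem ofIdx_smul (i : ι) (x : V) :
    RootPairing.weylGroup.ofIdx P i • x = P.reflection i x := rfl

theorem ofIdx_mul_self (i : ι) :
    RootPairing.weylGroup.ofIdx P i * RootPairing.weylGroup.ofIdx P i = 1 := by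
  refine Subtype.ext (RootPairing.Equiv.weightHom_injective P ?_)
  refine LinearEquiv.ext fun x => ?_
  change P.reflection i (P.reflection i x) = x
  exact P.reflection_same i x

theorem ofIdx_inv (i : ι) :
    (RootPairing.weylGroup.ofIdx P i)⁻¹ = RootPairing.weylGroup.ofIdx P i :=
  inv_eq_of_mul_eq_one_left (ofIdx_mul_self i)

theorem ofIdx_reflectionPerm (i j : ι) : RootPairing.weylGroup.ofIdx P (P.reflectionPerm j i) =
      RootPairing.weylGroup.ofIdx P j * RootPairing.weylGroup.ofIdx P i *
        RootPairing.weylGroup.ofIdx P j := by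
  refine Subtype.ext (RootPairing.Equiv.weightHom_injective P ?_)
  refine LinearEquiv.ext fun x => ?_
  change P.reflection (P.reflectionPerm j i) x =
    P.reflection j (P.reflection i (P.reflection j x))
  rw [RootPairing.reflection_reflectionPerm]
  rfl

theorem weylGroup_induction {p : P.weylGroup → Prop} (one : p 1)
    (mul : ∀ i w, p w → p (RootPairing.weylGroup.ofIdx P i * w)) (w : P.weylGroup) : p w := by
  suffices ∀ v, p v → p (w * v) by simpa using this 1 one
  obtain ⟨w, hw⟩ := w
  induction hw using RootPairing.weylGroup.induction with
  | mem i => exact mul i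
  | one => intro v hv; exact (one_mul v).symm ▸ hv
  | mul x y hx hy ihx ihy =>
    intro v hv
    have := ihx _ (ihy _ hv)
    rwa [← mul_assoc] at this

theorem ofIdx_perm (w : P.weylGroup) (i : ι) :
    RootPairing.weylGroup.ofIdx P (P.weylGroupToPerm w i) =
      w * RootPairing.weylGroup.ofIdx P i * w⁻¹ := by
  induction w using weylGroup_induction generalizing i with
  | one => simp
  | mul j w ih =>
    rw [perm_mul, perm_ofIdx, ofIdx_reflectionPerm, ih, mul_inv_rev, ofIdx_inv]
    group

theorem ofIdx_opp (i : ι) :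
    RootPairing.weylGroup.ofIdx P (opp P i) = RootPairing.weylGroup.ofIdx P i := by
  rw [opp, ofIdx_reflectionPerm, ofIdx_mul_self, one_mul]

/-- Invariance of the pairing, with the action on coroots expressed through the permutation of the
indices. -/
theorem pairing_smul_perm (w : P.weylGroup) (x : V) (i : ι) :
    P.toLinearMap (w • x) (P.coroot (P.weylGroupToPerm w i)) = P.toLinearMap x (P.coroot i) := by
  induction w using weylGroup_induction generalizing i with
  | one => simp
  | mul j w ih =>
    rw [← ih i, perm_mul, mul_smul, perm_ofIdx, ofIdx_smul]
    have := P.coroot'_reflection (i := j) (j := P.reflectionPerm j (P.weylGroupToPerm w i)) (w • x)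
    rw [RootPairing.reflectionPerm_self] at this
    exact this

variable (b : P.Base)

theorem isPos_opp (i : ι) : b.IsPos (opp P i) ↔ ¬ b.IsPos i :=
  RootPairing.Base.IsPos.neg_iff_not b i

theorem simpleReflection_smul (i : b.support) (x : V) :
    simpleReflection b i • x = P.reflection i x := rfl

/-- The product of the simple reflections in a word. -/
noncomputable def wordProd (l : List b.support) : P.weylGroup := (l.map (simpleReflection b)).prod

@[simp]
theorem wordProd_nil : wordProd b [] = 1 := rfl

@[simp]
theorem wordProd_cons (s : b.support) (l : List b.support) :
    wordProd b (s :: l) = simpleReflection b s * wordProd b l := by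
  simp [wordProd]

theorem wordProd_append (l l' : List b.support) :
    wordProd b (l ++ l') = wordProd b l * wordProd b l' := by
  simp [wordProd]

theorem simpleReflection_mul_self (s : b.support) :
    simpleReflection b s * simpleReflection b s = 1 := ofIdx_mul_self _

theorem simpleReflection_inv (s : b.support) :
    (simpleReflection b s)⁻¹ = simpleReflection b s := ofIdx_inv _

theorem wordProd_reverse (l : List b.support) : wordProd b l.reverse = (wordProd b l)⁻¹ := by
  induction l with
  | nil => simp
  | cons s l ih =>
    rw [List.reverse_cons, wordProd_append, ih, wordProd_cons, wordProd_cons, mul_inv_rev,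
      simpleReflection_inv, wordProd_nil, mul_one]

/-- The words obtained by deleting a letter `s_i` of the word `s_1, …, s_k`, together with the
roots `s_k ⋯ s_{i+1} α_i`. -/
noncomputable def deletions : List b.support → List (ι × List b.support)
  | [] => []
  | s :: l => (P.weylGroupToPerm (wordProd b l)⁻¹ s, l) ::
      (deletions l).map (Prod.map id (s :: ·))

theorem length_of_mem_deletions {l : List b.support} {x : ι × List b.support}
    (hx : x ∈ deletions b l) : x.2.length + 1 = l.length := by
  induction l generalizing x with
  | nil => simp [deletions] at hx
  | cons s l ih =>
    rw [deletions, List.mem_cons, List.mem_map] at hx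
    rcases hx with rfl | ⟨y, hy, rfl⟩
    · rfl
    · simpa using ih hy

/-- Moving the removed letter $s_i$ to the right end conjugates it by the letters after it, which
gives the reflection in $s_k\cdots s_{i+1}\alpha_i$. -/
theorem wordProd_of_mem_deletions {l : List b.support} {x : ι × List b.support}
    (hx : x ∈ deletions b l) :
    wordProd b x.2 = wordProd b l * RootPairing.weylGroup.ofIdx P x.1 := by
  induction l generalizing x with
  | nil => simp [deletions] at hx
  | cons s l ih =>
    rw [deletions, List.mem_cons, List.mem_map] at hx
    rcases hx with rfl | ⟨y, hy, rfl⟩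
    · rw [wordProd_cons, ofIdx_perm]
      change _ = simpleReflection b s * _ * (_ * simpleReflection b s * _)
      rw [mul_assoc, inv_inv, ← mul_assoc (wordProd b l), ← mul_assoc (wordProd b l),
        mul_inv_cancel, one_mul, ← mul_assoc, simpleReflection_mul_self, one_mul]
    · simp only [Prod.map_snd, Prod.map_fst, id, wordProd_cons, ih hy, mul_assoc]

/-- The inversion set of `w`: the positive roots that `w` makes negative. -/
def inversions (w : P.weylGroup) : Set ι := {i | b.IsPos i ∧ ¬ b.IsPos (P.weylGroupToPerm w i)}

theorem inversions_one : inversions b (1 : P.weylGroup) = ∅ := by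
  ext i; simp [inversions]

theorem perm_simple_self (s : b.support) :
    P.weylGroupToPerm (simpleReflection b s) s = opp P s := perm_ofIdx _ _

theorem isPos_simple (s : b.support) : b.IsPos (s : ι) :=
  RootPairing.Base.isPos_of_mem_support s.2

theorem notMem_inversions (s : b.support) (w : P.weylGroup) :
    P.weylGroupToPerm w⁻¹ s ∉ inversions b w := by
  simp [inversions, isPos_simple]

theorem opp_notMem_inversions (s : b.support) (w : P.weylGroup) :
    opp P (P.weylGroupToPerm w⁻¹ s) ∉ inversions b (simpleReflection b s * w) := by
  have := notMem_inversions b s (simpleReflection b s * w)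
  rwa [mul_inv_rev, perm_mul, simpleReflection_inv, perm_simple_self, perm_opp] at this

theorem weylLength_le (l : List b.support) : weylLength b (wordProd b l) ≤ l.length :=
  Nat.sInf_le ⟨l, rfl, rfl⟩

variable [Finite ι] [P.IsCrystallographic] [P.IsReduced]

/-- A simple reflection permutes the positive roots other than its own. The equivalence follows from
that implication by applying the reflection twice. -/
theorem isPos_simple_perm_iff (s : b.support) {i : ι} (h1 : i ≠ s) (h2 : i ≠ opp P s) :
    b.IsPos (P.weylGroupToPerm (simpleReflection b s) i) ↔ b.IsPos i := by
  have key : ∀ j : ι, j ≠ s → b.IsPos j → b.IsPos (P.reflectionPerm s j) := fun j hj hp =>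
    hp.reflectionPerm s.2 hj
  rw [simpleReflection, perm_ofIdx]
  refine ⟨fun h => ?_, key i h1⟩
  have := key _ (fun h' => h2 ?_) h
  · rwa [RootPairing.reflectionPerm_self] at this
  · have h3 : P.reflectionPerm s (P.reflectionPerm s i) = opp P s := congrArg _ h'
    rwa [RootPairing.reflectionPerm_self] at h3

/-- Left multiplication by $s$ changes the sign only of the roots that $w$ sends to $\pm\alpha_s$,
so exactly one inversion is gained. -/
theorem inversions_simple_mul_of_pos (s : b.support) (w : P.weylGroup)
    (h : b.IsPos (P.weylGroupToPerm w⁻¹ s)) :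
    inversions b (simpleReflection b s * w) =
      insert (P.weylGroupToPerm w⁻¹ s) (inversions b w) := by
  have hw : P.weylGroupToPerm w (P.weylGroupToPerm w⁻¹ s) = s := by rw [← perm_mul]; simp
  ext i
  by_cases h1 : P.weylGroupToPerm w i = s
  · obtain rfl : i = P.weylGroupToPerm w⁻¹ s := (P.weylGroupToPerm w).injective (h1.trans hw.symm)
    simp only [inversions, Set.mem_ofPred_eq, perm_mul, hw, perm_simple_self, isPos_opp, h,
      isPos_simple, Set.mem_insert_iff, true_or, not_true, not_false_eq_true, and_self]
  · have h1' : i ≠ P.weylGroupToPerm w⁻¹ s := fun h' => h1 (h' ▸ hw)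
    by_cases h2 : P.weylGroupToPerm w i = opp P s
    · have : i = opp P (P.weylGroupToPerm w⁻¹ s) :=
        (P.weylGroupToPerm w).injective (by rw [h2, perm_opp, hw])
      have hi : ¬ b.IsPos i := by rw [this, isPos_opp, not_not]; exact h
      simp only [inversions, Set.mem_ofPred_eq, hi, h1', false_and, Set.mem_insert_iff, or_self]
    · simp only [inversions, Set.mem_ofPred_eq, perm_mul, isPos_simple_perm_iff b s h1 h2,
        Set.mem_insert_iff, h1', false_or]

theorem inversions_simple_mul_of_neg (s : b.support) (w : P.weylGroup)
    (h : ¬ b.IsPos (P.weylGroupToPerm w⁻¹ s)) :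
    inversions b w = insert (opp P (P.weylGroupToPerm w⁻¹ s))
      (inversions b (simpleReflection b s * w)) := by
  have := inversions_simple_mul_of_pos b s (simpleReflection b s * w) (by
    rw [mul_inv_rev, perm_mul, simpleReflection_inv, perm_simple_self, perm_opp, isPos_opp]
    exact h)
  rwa [← mul_assoc, simpleReflection_mul_self, one_mul, mul_inv_rev, perm_mul,
    simpleReflection_inv, perm_simple_self, perm_opp] at this

theorem ncard_inversions_of_pos (s : b.support) (w : P.weylGroup)
    (h : b.IsPos (P.weylGroupToPerm w⁻¹ s)) :
    (inversions b (simpleReflection b s * w)).ncard = (inversions b w).ncard + 1 := by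
  rw [inversions_simple_mul_of_pos b s w h,
    Set.ncard_insert_of_notMem (notMem_inversions b s w) (Set.toFinite _)]

theorem ncard_inversions_of_neg (s : b.support) (w : P.weylGroup)
    (h : ¬ b.IsPos (P.weylGroupToPerm w⁻¹ s)) :
    (inversions b w).ncard = (inversions b (simpleReflection b s * w)).ncard + 1 := by
  rw [inversions_simple_mul_of_neg b s w h,
    Set.ncard_insert_of_notMem (opp_notMem_inversions b s w) (Set.toFinite _)]

/-- The sum of an odd function over the roots attached to the deletions of a word is its sum over
the inversions of the product of the word. -/
theorem sum_deletions {M : Type*} [AddCommGroup M] (h : ι → M) (hodd : ∀ i, h (opp P i) = - h i)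
    (l : List b.support) :
    ((deletions b l).map fun x => h x.1).sum = ∑ᶠ i ∈ inversions b (wordProd b l), h i := by
  induction l with
  | nil => simp [deletions, inversions_one]
  | cons s l ih =>
    rw [deletions, List.map_cons, List.sum_cons, List.map_map]
    change _ + ((deletions b l).map fun x => h x.1).sum = _
    rw [ih, wordProd_cons]
    by_cases hp : b.IsPos (P.weylGroupToPerm (wordProd b l)⁻¹ s)
    · rw [inversions_simple_mul_of_pos b s _ hp,
        finsum_mem_insert _ (notMem_inversions b s _) (Set.toFinite _)]
    -- Here the new letter removes an inversion. Its deletion root is the opposite of that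
    -- inversion, so by oddness the two terms cancel.
    · rw [inversions_simple_mul_of_neg b s _ hp,
        finsum_mem_insert _ (opp_notMem_inversions b s _) (Set.toFinite _), hodd,
        add_neg_cancel_left]

/-- Strong exchange property: an inversion must have entered the inversion set at some letter of the
word. -/
theorem exists_deletion_of_mem_inversions {l : List b.support} {i : ι}
    (hi : i ∈ inversions b (wordProd b l)) : ∃ x ∈ deletions b l, i = x.1 ∨ i = opp P x.1 := by
  induction l generalizing i with
  | nil => simp [inversions_one] at hi
  | cons s l ih =>
    rw [wordProd_cons] at hi
    by_cases hi' : i ∈ inversions b (wordProd b l)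
    · obtain ⟨x, hx, h⟩ := ih hi'
      exact ⟨_, List.mem_cons_of_mem _ (List.mem_map_of_mem hx), h⟩
    · by_cases hp : b.IsPos (P.weylGroupToPerm (wordProd b l)⁻¹ s)
      · rw [inversions_simple_mul_of_pos b s _ hp, Set.mem_insert_iff] at hi
        exact ⟨_, List.mem_cons_self, Or.inl (hi.resolve_right hi')⟩
      · rw [inversions_simple_mul_of_neg b s _ hp] at hi'
        exact (hi' (Set.mem_insert_of_mem _ hi)).elim

/-! ### Length -/

theorem exists_word (w : P.weylGroup) :
    ∃ l : List b.support, wordProd b l = w ∧ l.length = weylLength b w :=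
  exists_isReducedExpr b w

theorem tail_reduced {s : b.support} {l : List b.support}
    (hl : (s :: l).length = weylLength b (wordProd b (s :: l))) :
    l.length = weylLength b (wordProd b l) := by
  refine le_antisymm ?_ (weylLength_le b l)
  obtain ⟨m, hm, hm'⟩ := exists_word b (wordProd b l)
  have := weylLength_le b (s :: m)
  rw [wordProd_cons, hm, ← wordProd_cons, ← hl, List.length_cons, List.length_cons] at this
  omega

/-- Each letter of a reduced word adds an inversion. If $s$ removed one instead, the exchange
property would give a word for $sw$ by deleting a letter of the word for $w$, two letters shorter
than the reduced one. -/
theorem ncard_inversions_of_reduced (l : List b.support)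
    (hl : l.length = weylLength b (wordProd b l)) :
    (inversions b (wordProd b l)).ncard = l.length := by
  induction l with
  | nil => simp [inversions_one]
  | cons s l ih =>
    have h1 := tail_reduced b hl
    rw [wordProd_cons]
    by_cases hp : b.IsPos (P.weylGroupToPerm (wordProd b l)⁻¹ s)
    · rw [ncard_inversions_of_pos b s _ hp, ih h1, List.length_cons]
    · exfalso
      have hmem : opp P (P.weylGroupToPerm (wordProd b l)⁻¹ s) ∈ inversions b (wordProd b l) := by
        rw [inversions_simple_mul_of_neg b s _ hp]
        exact Set.mem_insert _ _
      obtain ⟨x, hx, hxe⟩ := exists_deletion_of_mem_inversions b hmem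
      have hx1 : RootPairing.weylGroup.ofIdx P x.1 =
          RootPairing.weylGroup.ofIdx P (P.weylGroupToPerm (wordProd b l)⁻¹ s) := by
        rcases hxe with h | h
        · rw [← h, ofIdx_opp]
        · rw [← opp_opp P (P.weylGroupToPerm (wordProd b l)⁻¹ s), h, opp_opp]
      have hprod : wordProd b x.2 = wordProd b (s :: l) := by
        rw [wordProd_of_mem_deletions b hx, hx1, ofIdx_perm, wordProd_cons, inv_inv, ← mul_assoc,
          ← mul_assoc, mul_inv_cancel, one_mul]
        rfl
      have h2 := weylLength_le b x.2
      have h3 := length_of_mem_deletions b hx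
      rw [hprod, ← hl, List.length_cons] at h2
      omega

theorem weylLength_eq (w : P.weylGroup) : weylLength b w = (inversions b w).ncard := by
  obtain ⟨l, rfl, hl⟩ := exists_word b w
  rw [ncard_inversions_of_reduced b l hl, hl]

theorem weylLength_one : weylLength b (1 : P.weylGroup) = 0 := by
  rw [weylLength_eq, inversions_one, Set.ncard_empty]

theorem eq_one_of_weylLength_eq_zero {w : P.weylGroup} (h : weylLength b w = 0) : w = 1 := by
  obtain ⟨l, rfl, hl⟩ := exists_word b w
  rw [h, List.length_eq_zero_iff] at hl
  rw [hl, wordProd_nil]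

theorem weylLength_inv (w : P.weylGroup) : weylLength b w⁻¹ = weylLength b w := by
  have key : ∀ v : P.weylGroup, weylLength b v⁻¹ ≤ weylLength b v := by
    intro v
    obtain ⟨l, rfl, hl⟩ := exists_word b v
    rw [← wordProd_reverse, ← hl, ← List.length_reverse]
    exact weylLength_le b _
  exact le_antisymm (key w) (by simpa using key w⁻¹)

theorem weylLength_simple_mul_of_pos (s : b.support) (w : P.weylGroup)
    (h : b.IsPos (P.weylGroupToPerm w⁻¹ s)) :
    weylLength b (simpleReflection b s * w) = weylLength b w + 1 := by
  rw [weylLength_eq, weylLength_eq, ncard_inversions_of_pos b s w h]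

theorem weylLength_simple_mul_of_neg (s : b.support) (w : P.weylGroup)
    (h : ¬ b.IsPos (P.weylGroupToPerm w⁻¹ s)) :
    weylLength b w = weylLength b (simpleReflection b s * w) + 1 := by
  rw [weylLength_eq, weylLength_eq, ncard_inversions_of_neg b s w h]

/-- The sign character of the Weyl group. -/
noncomputable def weylSign (w : P.weylGroup) : ℂ := (-1) ^ weylLength b w

theorem weylSign_simple_mul (s : b.support) (w : P.weylGroup) :
    weylSign b (simpleReflection b s * w) = - weylSign b w := by
  unfold weylSign
  by_cases hp : b.IsPos (P.weylGroupToPerm w⁻¹ s)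
  · rw [weylLength_simple_mul_of_pos b s w hp, pow_succ]; ring
  · rw [weylLength_simple_mul_of_neg b s w hp, pow_succ]; ring

theorem weylSign_wordProd (l : List b.support) : weylSign b (wordProd b l) = (-1) ^ l.length := by
  induction l with
  | nil => simp [weylSign, weylLength_one]
  | cons s l ih => rw [wordProd_cons, weylSign_simple_mul, ih, List.length_cons, pow_succ]; ring

/-- The sign of the product is $(-1)$ to the length of any word for it, so the excess over the
reduced length is even. -/
theorem exists_padding (l : List b.support) :
    ∃ n, l.length = weylLength b (wordProd b l) + 2 * n := by
  have h := weylSign_wordProd b l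
  obtain ⟨n, hn⟩ := Nat.exists_eq_add_of_le (weylLength_le b l)
  unfold weylSign at h
  rw [hn, pow_add] at h
  have h2 : ((-1 : ℂ)) ^ n = 1 := by
    have h0 : ((-1 : ℂ)) ^ weylLength b (wordProd b l) ≠ 0 := pow_ne_zero _ (by norm_num)
    exact (mul_left_cancel₀ h0 (by rw [mul_one]; exact h)).symm
  rcases Nat.even_or_odd n with he | ho
  · obtain ⟨k, hk⟩ := he
    exact ⟨k, by omega⟩
  · rw [ho.neg_one_pow] at h2
    norm_num at h2

/-- A root and its coroot are positive together: both signs behave in the same way under simple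
reflections, starting from the simple roots. -/
theorem isPos_flip_iff (i : ι) : b.flip.IsPos i ↔ b.IsPos i := by
  refine b.induction_reflect (p := fun i => b.flip.IsPos i ↔ b.IsPos i) i ?_ ?_ ?_
  · intro i hi
    rw [← not_iff_not] at hi
    change b.flip.IsPos (opp P.flip i) ↔ b.IsPos (opp P i)
    rw [isPos_opp, isPos_opp, hi]
  · intro i hi
    exact iff_of_true (RootPairing.Base.isPos_of_mem_support (b := b.flip) hi)
      (RootPairing.Base.isPos_of_mem_support hi)
  · intro i j hi hj
    by_cases h1 : i = j
    · subst h1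
      change b.flip.IsPos (opp P.flip i) ↔ b.IsPos (opp P i)
      rw [isPos_opp, isPos_opp, hi]
    · by_cases h2 : i = opp P j
      · subst h2
        have : P.reflectionPerm j (opp P j) = j := RootPairing.reflectionPerm_self _ _ _
        rw [this]
        exact iff_of_true (RootPairing.Base.isPos_of_mem_support (b := b.flip) hj)
          (RootPairing.Base.isPos_of_mem_support hj)
      · have e1 := isPos_simple_perm_iff b ⟨j, hj⟩ h1 h2
        have e2 := isPos_simple_perm_iff b.flip ⟨j, hj⟩ h1 h2
        rw [simpleReflection, perm_ofIdx] at e1 e2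
        rw [e1, ← hi, ← e2]
        rfl

/-- A weight on which the simple coroots take the value `1` takes positive integral values on the
positive coroots. -/
theorem exists_regular_weight [P.IsRootSystem] :
    ∃ x : V, ∀ i, b.IsPos i → ∃ n : ℕ, 0 < n ∧ P.toLinearMap x (P.coroot i) = n := by
  let g : V' →ₗ[ℂ] ℂ := b.toCoweightBasis.constr ℂ fun _ => (1 : ℂ)
  have hg : ∀ j ∈ b.support, g (P.coroot j) = 1 := fun j hj => by
    have := b.toCoweightBasis.constr_basis ℂ (fun _ => (1 : ℂ)) ⟨j, hj⟩
    rwa [RootPairing.Base.toCoweightBasis_apply] at this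
  obtain ⟨x, hx⟩ : ∃ x, P.toLinearMap x = g := P.toLinearMap.toPerfPair.surjective g
  refine ⟨x, fun i hi => ?_⟩
  obtain ⟨f, -, -, hf⟩ := b.flip.exists_root_eq_sum_int i
  have hh := RootPairing.Base.height_eq_sum hf
  -- The value of the weight on a coroot is the height of that coroot for the flipped base.
  have h0 : 0 < b.flip.height i := (isPos_flip_iff b i).2 hi
  refine ⟨(b.flip.height i).toNat, by omega, ?_⟩
  have hf' : P.coroot i = ∑ j ∈ b.support, f j • P.coroot j := hf
  have : P.toLinearMap x (P.coroot i) = (b.flip.height i : ℂ) := by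
    rw [hx, hf', map_sum, hh]
    push_cast
    refine Finset.sum_congr rfl fun j hj => ?_
    rw [map_zsmul, hg j hj, zsmul_eq_mul, mul_one]
  rw [this]
  exact_mod_cast (Int.toNat_of_nonneg h0.le).symm

end Roots

end Coinvariant

namespace Coinvariant

/-! ### Parabolic subgroups, their roots and their longest elements. -/

section Parabolic

variable {ι : Type*} {V : Type u} {V' : Type*} [AddCommGroup V] [Module ℂ V] [AddCommGroup V']
  [Module ℂ V'] {P : RootPairing ι ℂ V V'} (b : P.Base) (J : Set b.support)

/-- The indices of the roots in `Φ_J = Φ ∩ ℤJ`. -/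
def parabolicRoots : Set ι :=
  {i | P.root i ∈ Submodule.span ℤ ((fun j : b.support => P.root j) '' J)}

theorem mem_parabolicRoots_of_mem {s : b.support} (hs : s ∈ J) : (s : ι) ∈ parabolicRoots b J :=
  Submodule.subset_span ⟨s, hs, rfl⟩

theorem opp_mem_parabolicRoots {i : ι} : opp P i ∈ parabolicRoots b J ↔ i ∈ parabolicRoots b J := by
  rw [parabolicRoots, Set.mem_ofPred_eq, Set.mem_ofPred_eq, root_opp, neg_mem_iff]

theorem exists_word_of_mem_parabolic {w : P.weylGroup} (hw : w ∈ parabolic b J) :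
    ∃ l : List b.support, (∀ t ∈ l, t ∈ J) ∧ wordProd b l = w := by
  induction hw using Subgroup.closure_induction with
  | mem x hx =>
    obtain ⟨s, hs, rfl⟩ := hx
    exact ⟨[s], by simpa using hs, by simp⟩
  | one => exact ⟨[], by simp, rfl⟩
  | mul x y _ _ hx hy =>
    obtain ⟨l, hl, rfl⟩ := hx
    obtain ⟨m, hm, rfl⟩ := hy
    refine ⟨l ++ m, fun t ht => ?_, wordProd_append b l m⟩
    exact (List.mem_append.1 ht).elim (hl t) (hm t)
  | inv x _ hx =>
    obtain ⟨l, hl, rfl⟩ := hx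
    exact ⟨l.reverse, fun t ht => hl t (List.mem_reverse.1 ht), wordProd_reverse b l⟩

theorem simpleReflection_mem_parabolic {s : b.support} (hs : s ∈ J) :
    simpleReflection b s ∈ parabolic b J := Subgroup.subset_closure ⟨s, hs, rfl⟩

theorem wordProd_mem_parabolic {l : List b.support} (hl : ∀ t ∈ l, t ∈ J) :
    wordProd b l ∈ parabolic b J := by
  induction l with
  | nil => exact one_mem _
  | cons s l ih =>
    rw [wordProd_cons]
    exact mul_mem (simpleReflection_mem_parabolic b J (hl s (by simp)))
      (ih fun t ht => hl t (by simp [ht]))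

theorem perm_mem_parabolicRoots [P.IsCrystallographic] {w : P.weylGroup} (hw : w ∈ parabolic b J)
    {i : ι} (hi : i ∈ parabolicRoots b J) : P.weylGroupToPerm w i ∈ parabolicRoots b J := by
  obtain ⟨l, hl, rfl⟩ := exists_word_of_mem_parabolic b J hw
  clear hw
  induction l with
  | nil => simpa using hi
  | cons s l ih =>
    have h1 := ih fun t ht => hl t (by simp [ht])
    rw [wordProd_cons, perm_mul, simpleReflection, perm_ofIdx]
    rw [parabolicRoots, Set.mem_ofPred_eq] at h1 ⊢
    rw [RootPairing.root_reflectionPerm, RootPairing.reflection_apply_root' ℤ]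
    exact sub_mem h1 (Submodule.smul_mem _ _ (Submodule.subset_span ⟨s, hl s (by simp), rfl⟩))

theorem mem_parabolicRoots_of_mem_deletions [P.IsCrystallographic] {l : List b.support}
    (hl : ∀ t ∈ l, t ∈ J) {x : ι × List b.support} (hx : x ∈ deletions b l) :
    x.1 ∈ parabolicRoots b J := by
  induction l generalizing x with
  | nil => simp [deletions] at hx
  | cons s l ih =>
    have hl' : ∀ t ∈ l, t ∈ J := fun t ht => hl t (by simp [ht])
    rw [deletions, List.mem_cons, List.mem_map] at hx
    rcases hx with rfl | ⟨y, hy, rfl⟩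
    · exact perm_mem_parabolicRoots b J (inv_mem (wordProd_mem_parabolic b J hl'))
        (mem_parabolicRoots_of_mem b J (hl s (by simp)))
    · exact ih hl' (x := y) hy

/-- Simple roots are linearly independent over $\mathbb Z$. -/
theorem mem_of_mem_parabolicRoots {s : b.support} (hs : (s : ι) ∈ parabolicRoots b J) : s ∈ J := by
  have hli : LinearIndependent ℤ fun j : b.support => P.root j :=
    b.linearIndepOn_root.restrict_scalars' ℤ
  by_contra h
  exact hli.notMem_span_image h hs

section

variable [P.IsRootSystem]

/-- If `w` makes all simple roots in `J` negative, then it makes all positive roots in `Φ_J`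
negative. -/
theorem not_isPos_perm_of_simple {w : P.weylGroup}
    (hw : ∀ s ∈ J, ¬ b.IsPos (P.weylGroupToPerm w s)) {i : ι} (hi : b.IsPos i)
    (hiJ : i ∈ parabolicRoots b J) : ¬ b.IsPos (P.weylGroupToPerm w i) := by
  -- This form extends the height linearly. The height of $w\alpha_i$ is then the sum of the heights
  -- of the $w\alpha_j$, weighted by the nonnegative coefficients of $\alpha_i$, which are supported
  -- on $J$.
  let h : V →ₗ[ℂ] ℂ := b.toWeightBasis.constr ℂ fun _ => (1 : ℂ)
  have hroot : ∀ k, h (P.root k) = b.height k := fun k => by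
    obtain ⟨f, -, -, hf⟩ := b.exists_root_eq_sum_int k
    rw [RootPairing.Base.height_eq_sum hf, hf, map_sum]
    push_cast
    refine Finset.sum_congr rfl fun j hj => ?_
    have := b.toWeightBasis.constr_basis ℂ (fun _ => (1 : ℂ)) ⟨j, hj⟩
    rw [RootPairing.Base.toWeightBasis_apply] at this
    rw [map_zsmul, zsmul_eq_mul, show h (P.root j) = 1 from this, mul_one]
  have hli : LinearIndependent ℤ fun j : b.support => P.root j :=
    b.linearIndepOn_root.restrict_scalars' ℤ
  obtain ⟨c, hcJ, hc⟩ := (Finsupp.mem_span_image_iff_linearCombination ℤ).1 hiJ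
  rw [Finsupp.linearCombination_apply, Finsupp.sum_fintype _ _ (by simp)] at hc
  obtain ⟨f, -, hf0, hf⟩ := b.exists_root_eq_sum_int i
  have hcf : ∀ j : b.support, c j = f j := by
    refine Fintype.linearIndependent_iffₛ.1 hli c (fun j => f j) ?_
    rw [hc, hf, ← Finset.sum_coe_sort b.support]
  have hf1 : 0 < f := by
    refine hf0.resolve_right fun hneg => ?_
    have := (b.isPos_iff).1 hi
    rw [RootPairing.Base.height_eq_sum hf] at this
    exact absurd this (not_lt.2 (Finset.sum_nonpos fun j _ => hneg.le j))
  have hsum : b.height (P.weylGroupToPerm w i) =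
      ∑ j : b.support, c j * b.height (P.weylGroupToPerm w j) := by
    have h1 : P.root (P.weylGroupToPerm w i) =
        ∑ j : b.support, c j • P.root (P.weylGroupToPerm w j) := by
      rw [← smul_root, ← hc, Finset.smul_sum]
      refine Finset.sum_congr rfl fun j _ => ?_
      rw [← smul_root, smul_comm]
    have h2 := congrArg h h1
    rw [hroot, map_sum] at h2
    simp only [map_zsmul, hroot, zsmul_eq_mul] at h2
    exact_mod_cast h2
  rw [b.isPos_iff, hsum, not_lt]
  refine Finset.sum_nonpos fun j _ => ?_
  by_cases hj : j ∈ J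
  · have h3 := hw j hj
    rw [b.isPos_iff, not_lt] at h3
    exact mul_nonpos_of_nonneg_of_nonpos (by rw [hcf]; exact hf1.le j) h3
  · rw [Finsupp.notMem_support_iff.1 fun h' => hj (hcJ h'), zero_mul]

variable [Finite ι]

theorem longest_mem : longest b J ∈ parabolic b J := (exists_longest b J).choose_spec.1

theorem weylLength_le_longest {u : P.weylGroup} (hu : u ∈ parabolic b J) :
    weylLength b u ≤ weylLength b (longest b J) := (exists_longest b J).choose_spec.2 u hu

end

variable [Finite ι] [P.IsCrystallographic] [P.IsReduced]

/-- The deletion roots of a word in $J$ lie in $\Phi_J$, and every inversion is one of them up to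
sign. -/
theorem inversions_subset_parabolicRoots {w : P.weylGroup} (hw : w ∈ parabolic b J) :
    inversions b w ⊆ parabolicRoots b J := by
  obtain ⟨l, hl, rfl⟩ := exists_word_of_mem_parabolic b J hw
  intro i hi
  obtain ⟨x, hx, h⟩ := exists_deletion_of_mem_inversions b hi
  have := mem_parabolicRoots_of_mem_deletions b J hl hx
  rcases h with rfl | rfl
  · exact this
  · exact (opp_mem_parabolicRoots b J).2 this

theorem isPos_of_reduced {s : b.support} {l : List b.support}
    (hl : (s :: l).length = weylLength b (wordProd b (s :: l))) :
    b.IsPos (P.weylGroupToPerm (wordProd b l)⁻¹ s) := by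
  by_contra hp
  have h1 := weylLength_simple_mul_of_neg b s _ hp
  rw [← wordProd_cons, ← hl, ← tail_reduced b hl, List.length_cons] at h1
  omega

/-- The first letter $s$ of a reduced word for $w$ makes $\alpha_s$ an inversion of $w^{-1} \in
W_J$, so $\alpha_s \in \Phi_J$ and $s \in J$. Stripping it leaves a reduced word of an element of
$W_J$. -/
theorem mem_of_mem_reduced {l : List b.support} (hl : l.length = weylLength b (wordProd b l))
    (hw : wordProd b l ∈ parabolic b J) {t : b.support} (ht : t ∈ l) : t ∈ J := by
  induction l with
  | nil => simp at ht
  | cons s l ih =>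
    have hp := isPos_of_reduced b hl
    have hs : s ∈ J := by
      apply mem_of_mem_parabolicRoots b J
      apply inversions_subset_parabolicRoots b J (inv_mem hw)
      refine ⟨isPos_simple b s, ?_⟩
      rw [wordProd_cons, mul_inv_rev, perm_mul, simpleReflection_inv, perm_simple_self, perm_opp,
        isPos_opp, not_not]
      exact hp
    rcases List.mem_cons.1 ht with rfl | ht
    · exact hs
    · refine ih (tail_reduced b hl) ?_ ht
      have := mul_mem (simpleReflection_mem_parabolic b J hs) hw
      rwa [wordProd_cons, ← mul_assoc, simpleReflection_mul_self, one_mul] at this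

variable [P.IsRootSystem]

/-- Maximality forbids $\ell(sw) > \ell(w)$ for $s \in J$, so $w^{-1}$ makes the simple roots in $J$
negative, and with them all of $\Phi_J^+$. -/
theorem inversions_eq_of_maximal {w : P.weylGroup} (hw : w ∈ parabolic b J)
    (hmax : ∀ u ∈ parabolic b J, weylLength b u ≤ weylLength b w) :
    inversions b w⁻¹ = {i | b.IsPos i ∧ i ∈ parabolicRoots b J} := by
  ext i
  refine ⟨fun hi => ⟨hi.1, inversions_subset_parabolicRoots b J (inv_mem hw) hi⟩, fun hi => ?_⟩
  refine ⟨hi.1, not_isPos_perm_of_simple b J (fun s hs hp => ?_) hi.1 hi.2⟩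
  have h1 := weylLength_simple_mul_of_pos b s w hp
  have h2 := hmax _ (mul_mem (simpleReflection_mem_parabolic b J hs) hw)
  omega

theorem inversions_longest :
    inversions b (longest b J) = {i | b.IsPos i ∧ i ∈ parabolicRoots b J} := by
  rw [← inversions_eq_of_maximal b J (inv_mem (longest_mem b J)), inv_inv]
  intro u hu
  rw [weylLength_inv]
  exact weylLength_le_longest b J hu

theorem weylLength_longest :
    weylLength b (longest b J) = {i | b.IsPos i ∧ i ∈ parabolicRoots b J}.ncard := by
  rw [weylLength_eq, inversions_longest]

theorem isPos_perm_longest_iff {i : ι} (hi : i ∈ parabolicRoots b J) :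
    b.IsPos (P.weylGroupToPerm (longest b J) i) ↔ ¬ b.IsPos i := by
  have key : ∀ j ∈ parabolicRoots b J, b.IsPos j →
      ¬ b.IsPos (P.weylGroupToPerm (longest b J) j) := fun j hj hp => by
    have : j ∈ inversions b (longest b J) := by
      rw [inversions_longest]
      exact ⟨hp, hj⟩
    exact this.2
  refine ⟨fun h hp => key i hi hp h, fun hp => ?_⟩
  have := key (opp P i) ((opp_mem_parabolicRoots b J).2 hi) ((isPos_opp b i).2 hp)
  rwa [perm_opp, isPos_opp, not_not] at this

/-- Since $w_J$ reverses all signs in $\Phi_J$, the inversions of $v$ and of $w_J v$ partition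
$\Phi_J^+$. -/
theorem weylLength_longest_mul {v : P.weylGroup} (hv : v ∈ parabolic b J) :
    weylLength b (longest b J * v) + weylLength b v = weylLength b (longest b J) := by
  rw [weylLength_eq, weylLength_eq, weylLength_longest, ← Set.ncard_union_eq _ (Set.toFinite _)
    (Set.toFinite _)]
  · congr 1
    ext i
    by_cases hi : i ∈ parabolicRoots b J
    · have := isPos_perm_longest_iff b J (perm_mem_parabolicRoots b J hv hi)
      simp only [inversions, Set.mem_union, Set.mem_ofPred_eq, perm_mul, this]
      tauto
    · exact iff_of_false (fun h => hi (h.elim (fun h1 => inversions_subset_parabolicRoots b J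
        (mul_mem (longest_mem b J) hv) h1) fun h2 => inversions_subset_parabolicRoots b J hv h2))
        fun h => hi h.2
  · rw [Set.disjoint_left]
    intro i h1 h2
    have hi := inversions_subset_parabolicRoots b J hv h2
    have := isPos_perm_longest_iff b J (perm_mem_parabolicRoots b J hv hi)
    rw [← perm_mul] at this
    exact h1.2 (this.2 h2.2)

theorem longest_inv : (longest b J)⁻¹ = longest b J := by
  have h := weylLength_longest_mul b J (longest_mem b J)
  have := eq_one_of_weylLength_eq_zero b (w := longest b J * longest b J) (by omega)
  exact inv_eq_of_mul_eq_one_left this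

theorem eq_longest {u : P.weylGroup} (hu : u ∈ parabolic b J)
    (h : weylLength b u = weylLength b (longest b J)) : u = longest b J := by
  have h1 := weylLength_longest_mul b J hu
  have h2 := eq_one_of_weylLength_eq_zero b (w := longest b J * u) (by omega)
  rw [← longest_inv]
  exact eq_inv_of_mul_eq_one_right h2

end Parabolic

end Coinvariant

namespace Coinvariant
open GradedRep

/-! ### Divisibility by linear forms and homogeneous factors in $S(V)$. -/

section Sym

variable {K : Type v} [Field K] {V : Type u} [AddCommGroup V] [Module K V]

theorem exists_basis_apply_eq {x : V} (hx : x ≠ 0) :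
    ∃ (κ : Type u) (B : Module.Basis κ K V) (i : κ), B i = x := by
  have hli : LinearIndepOn K id ({x} : Set V) := (linearIndepOn_singleton_iff K).2 hx
  refine ⟨_, Module.Basis.extend hli, ⟨x, hli.subset_extend _ rfl⟩, ?_⟩
  simp

/-- A nonzero vector extends to a basis, so its linear form is a variable of a polynomial ring. -/
theorem prime_ι {x : V} (hx : x ≠ 0) : Prime (SymmetricAlgebra.ι K V x) := by
  obtain ⟨κ, B, i, rfl⟩ := exists_basis_apply_eq (K := K) hx
  rw [← MulEquiv.prime_iff (SymmetricAlgebra.equivMvPolynomial B),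
    SymmetricAlgebra.equivMvPolynomial_ι_apply]
  exact MvPolynomial.X_prime

theorem ι_ne_zero {x : V} (hx : x ≠ 0) : SymmetricAlgebra.ι K V x ≠ 0 := (prime_ι hx).ne_zero

/-- Evaluate at a functional that kills $x$ but not $y$. -/
theorem not_ι_dvd_ι {x y : V} (h : y ∉ Submodule.span K {x}) :
    ¬ SymmetricAlgebra.ι K V x ∣ SymmetricAlgebra.ι K V y := by
  obtain ⟨f, hfy, hfx⟩ := Submodule.exists_le_ker_of_notMem h
  rintro ⟨g, hg⟩
  have h1 := congrArg (SymmetricAlgebra.lift f) hg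
  have hx : f x = 0 := hfx (Submodule.mem_span_singleton_self x)
  rw [map_mul, SymmetricAlgebra.lift_ι_apply, SymmetricAlgebra.lift_ι_apply, hx, zero_mul] at h1
  exact hfy h1

theorem symDeg_zero {f : SymmetricAlgebra K V} (hf : f ∈ symDeg K V 0) :
    ∃ c : K, f = algebraMap K _ c := by
  rcases mem_symDeg_iff.1 hf with rfl | ⟨j, hj, h⟩
  · exact ⟨0, (map_zero _).symm⟩
  · obtain rfl : j = 0 := by omega
    rw [pow_zero, Submodule.mem_one] at h
    exact h.imp fun c hc => hc.symm

/-- Taking homogeneous components commutes with multiplication by $a$ up to a shift of degree, and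
$a$ can be cancelled in the domain $S(V)$. -/
theorem mem_symDeg_of_mul_mem {a g : SymmetricAlgebra K V} {d e : ℤ} (ha : a ∈ symDeg K V d)
    (ha0 : a ≠ 0) (h : a * g ∈ symDeg K V e) : g ∈ symDeg K V (e - d) := by
  obtain ⟨p, hpm, hpi, hp0, hps⟩ := exists_proj (symDeg_isInternal (K := K) (V := V))
  have hpa : ∀ k, p k (a * g) = a * p (k - d) g := by
    intro k
    obtain ⟨s, hs⟩ := hps g
    rw [hs, Finset.mul_sum, map_sum, map_sum, Finset.mul_sum]
    refine Finset.sum_congr rfl fun i _ => ?_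
    have hm := mul_mem_symDeg d i a ha _ (hpm i g)
    by_cases hk : k = d + i
    · rw [hk, hpi _ _ hm, add_sub_cancel_left, hpi _ _ (hpm i g)]
    · rw [hp0 _ _ hk _ hm, hp0 _ _ (by omega) _ (hpm i g), mul_zero]
  have : a * g = a * p (e - d) g := by rw [← hpa, hpi _ _ h]
  rw [mul_left_cancel₀ ha0 this]
  exact hpm _ _

end Sym

/-! ### Demazure operators along words. -/

section Demazure

variable {ι : Type*} {V : Type u} {V' : Type*} [AddCommGroup V] [Module ℂ V] [AddCommGroup V']
  [Module ℂ V'] {P : RootPairing ι ℂ V V'} (b : P.Base)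

theorem ι_root_ne_zero (i : ι) : SymmetricAlgebra.ι ℂ V (P.root i) ≠ 0 := ι_ne_zero (P.ne_zero i)

theorem symAct_ι (w : P.weylGroup) (x : V) :
    symAct P w (SymmetricAlgebra.ι ℂ V x) = SymmetricAlgebra.ι ℂ V (w • x) :=
  SymmetricAlgebra.lift_ι_apply _ x

theorem symAct_mul_apply (w w' : P.weylGroup) (f : SymmetricAlgebra ℂ V) :
    symAct P (w * w') f = symAct P w (symAct P w' f) := by
  rw [map_mul]; rfl

theorem symAct_mem_symDeg (w : P.weylGroup) {d : ℤ} {f : SymmetricAlgebra ℂ V}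
    (hf : f ∈ symDeg ℂ V d) : symAct P w f ∈ symDeg ℂ V d := lift_mem_symDeg _ d f hf

theorem symAct_simple_simple (s : b.support) (f : SymmetricAlgebra ℂ V) :
    symAct P (simpleReflection b s) (symAct P (simpleReflection b s) f) = f := by
  rw [← symAct_mul_apply, simpleReflection_mul_self, map_one]; rfl

theorem symAct_simple_ι_root (s : b.support) :
    symAct P (simpleReflection b s) (SymmetricAlgebra.ι ℂ V (P.root s)) =
      - SymmetricAlgebra.ι ℂ V (P.root s) := by
  rw [symAct_ι, simpleReflection_smul, RootPairing.reflection_apply_self, map_neg]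

theorem demazure_unique {s : b.support} {f g : SymmetricAlgebra ℂ V}
    (h : f - symAct P (simpleReflection b s) f = SymmetricAlgebra.ι ℂ V (P.root s) * g) :
    demazure b s f = g :=
  mul_left_cancel₀ (ι_root_ne_zero (P := P) s) ((demazure_spec b s f).symm.trans h)

theorem demazure_add (s : b.support) (f g : SymmetricAlgebra ℂ V) :
    demazure b s (f + g) = demazure b s f + demazure b s g := by
  apply demazure_unique
  rw [mul_add, ← demazure_spec, ← demazure_spec, map_add]
  ring

theorem demazure_mul (s : b.support) (f g : SymmetricAlgebra ℂ V) :
    demazure b s (f * g) =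
      demazure b s f * g + symAct P (simpleReflection b s) f * demazure b s g := by
  apply demazure_unique
  rw [map_mul]
  linear_combination g * demazure_spec b s f +
    symAct P (simpleReflection b s) f * demazure_spec b s g

theorem demazure_eq_zero_iff (s : b.support) (f : SymmetricAlgebra ℂ V) :
    demazure b s f = 0 ↔ symAct P (simpleReflection b s) f = f := by
  constructor
  · intro h
    have := demazure_spec b s f
    rw [h, mul_zero, sub_eq_zero] at this
    exact this.symm
  · intro h
    apply demazure_unique
    rw [h, sub_self, mul_zero]

theorem demazure_algebraMap (s : b.support) (c : ℂ) :
    demazure b s (algebraMap ℂ (SymmetricAlgebra ℂ V) c) = 0 :=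
  (demazure_eq_zero_iff b s _).2 (AlgHom.commutes _ c)

theorem demazure_invariant_mul {s : b.support} {a : SymmetricAlgebra ℂ V}
    (ha : symAct P (simpleReflection b s) a = a) (f : SymmetricAlgebra ℂ V) :
    demazure b s (a * f) = a * demazure b s f := by
  rw [demazure_mul, (demazure_eq_zero_iff b s a).2 ha, zero_mul, zero_add, ha]

theorem demazure_smul (s : b.support) (c : ℂ) (f : SymmetricAlgebra ℂ V) :
    demazure b s (c • f) = c • demazure b s f := by
  rw [Algebra.smul_def, Algebra.smul_def, demazure_invariant_mul b (AlgHom.commutes _ c)]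

theorem symAct_demazure (s : b.support) (f : SymmetricAlgebra ℂ V) :
    symAct P (simpleReflection b s) (demazure b s f) = demazure b s f := by
  have h := congrArg (symAct P (simpleReflection b s)) (demazure_spec b s f)
  rw [map_sub, symAct_simple_simple, map_mul, symAct_simple_ι_root] at h
  apply mul_left_cancel₀ (ι_root_ne_zero (P := P) s)
  linear_combination h + demazure_spec b s f

theorem demazure_demazure (s : b.support) (f : SymmetricAlgebra ℂ V) :
    demazure b s (demazure b s f) = 0 :=
  (demazure_eq_zero_iff b s _).2 (symAct_demazure b s f)

theorem demazure_symAct (s : b.support) (f : SymmetricAlgebra ℂ V) :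
    demazure b s (symAct P (simpleReflection b s) f) = - demazure b s f := by
  apply demazure_unique
  rw [symAct_simple_simple]
  linear_combination - demazure_spec b s f

theorem demazure_ι (s : b.support) (x : V) :
    demazure b s (SymmetricAlgebra.ι ℂ V x) =
      algebraMap ℂ _ (P.toLinearMap x (P.coroot s)) := by
  apply demazure_unique
  rw [symAct_ι, simpleReflection_smul, RootPairing.reflection_apply, map_sub, map_smul,
    sub_sub_cancel, Algebra.smul_def, mul_comm]
  rfl

theorem demazure_mem_symDeg (s : b.support) {d : ℤ} {f : SymmetricAlgebra ℂ V}
    (hf : f ∈ symDeg ℂ V d) : demazure b s f ∈ symDeg ℂ V (d - 2) := by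
  refine mem_symDeg_of_mul_mem (ι_mem_symDeg (P.root s)) (ι_root_ne_zero (P := P) s) ?_
  rw [← demazure_spec]
  exact sub_mem hf (symAct_mem_symDeg _ hf)

@[simp]
theorem demazureWord_nil (f : SymmetricAlgebra ℂ V) : demazureWord b [] f = f := rfl

@[simp]
theorem demazureWord_cons (s : b.support) (l : List b.support) (f : SymmetricAlgebra ℂ V) :
    demazureWord b (s :: l) f = demazure b s (demazureWord b l f) := rfl

theorem demazureWord_append (l l' : List b.support) (f : SymmetricAlgebra ℂ V) :
    demazureWord b (l ++ l') f = demazureWord b l (demazureWord b l' f) := by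
  rw [demazureWord, List.foldr_append]; rfl

theorem demazureWord_add (l : List b.support) (f g : SymmetricAlgebra ℂ V) :
    demazureWord b l (f + g) = demazureWord b l f + demazureWord b l g := by
  induction l with
  | nil => rfl
  | cons s l ih => rw [demazureWord_cons, ih, demazure_add]; rfl

theorem demazureWord_smul (l : List b.support) (c : ℂ) (f : SymmetricAlgebra ℂ V) :
    demazureWord b l (c • f) = c • demazureWord b l f := by
  induction l with
  | nil => rfl
  | cons s l ih => rw [demazureWord_cons, ih, demazure_smul]; rfl

/-- `demazureWord` as a linear map. -/
noncomputable def demazureLinear (l : List b.support) :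
    SymmetricAlgebra ℂ V →ₗ[ℂ] SymmetricAlgebra ℂ V where
  toFun := demazureWord b l
  map_add' := demazureWord_add b l
  map_smul' := demazureWord_smul b l

theorem demazureWord_zero (l : List b.support) :
    demazureWord b l (0 : SymmetricAlgebra ℂ V) = 0 := map_zero (demazureLinear b l)

theorem demazureWord_mem_symDeg (l : List b.support) {d : ℤ} {f : SymmetricAlgebra ℂ V}
    (hf : f ∈ symDeg ℂ V d) : demazureWord b l f ∈ symDeg ℂ V (d - 2 * (l.length : ℤ)) := by
  induction l with
  | nil => simpa using hf
  | cons s l ih =>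
    have := demazure_mem_symDeg b s ih
    rw [demazureWord_cons, List.length_cons]
    convert this using 2
    push_cast
    ring

/-- The commutation rule of a Demazure operator with the multiplication by a linear form. -/
theorem demazureWord_ι_mul (l : List b.support) (x : V) (f : SymmetricAlgebra ℂ V) :
    demazureWord b l (SymmetricAlgebra.ι ℂ V x * f) =
      SymmetricAlgebra.ι ℂ V (wordProd b l • x) * demazureWord b l f +
      ((deletions b l).map fun y =>
        P.toLinearMap x (P.coroot y.1) • demazureWord b y.2 f).sum := by
  induction l with
  | nil => simp [deletions]
  | cons s l ih =>
    rw [demazureWord_cons, ih, demazure_add, demazure_mul, symAct_ι, ← mul_smul, ← wordProd_cons,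
      demazure_ι, ← Algebra.smul_def, deletions, List.map_cons, List.sum_cons, demazureWord_cons]
    have h1 : P.toLinearMap (wordProd b l • x) (P.coroot s) =
        P.toLinearMap x (P.coroot (P.weylGroupToPerm (wordProd b l)⁻¹ s)) := by
      rw [← pairing_smul_perm (wordProd b l) x, ← perm_mul, mul_inv_cancel, map_one]
      rfl
    have h2 : demazure b s ((deletions b l).map fun y =>
        P.toLinearMap x (P.coroot y.1) • demazureWord b y.2 f).sum =
        (((deletions b l).map (Prod.map id (s :: ·))).map fun y =>
          P.toLinearMap x (P.coroot y.1) • demazureWord b y.2 f).sum := by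
      have := map_list_sum (demazureLinear b [s]) ((deletions b l).map fun y =>
        P.toLinearMap x (P.coroot y.1) • demazureWord b y.2 f)
      refine this.trans ?_
      rw [List.map_map, List.map_map]
      congr 1
      refine List.map_congr_left fun y _ => ?_
      exact demazureWord_smul b [s] _ _
    rw [h1, h2]
    abel

theorem demazureWord_algebraMap {l : List b.support} (hl : l ≠ []) (c : ℂ) :
    demazureWord b l (algebraMap ℂ (SymmetricAlgebra ℂ V) c) = 0 := by
  rw [← List.dropLast_append_getLast hl, demazureWord_append, demazureWord_cons, demazureWord_nil,
    demazure_algebraMap, demazureWord_zero]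

variable [Finite ι] [P.IsCrystallographic] [P.IsReduced]

/-- `sum_deletions` applies because coroots are odd while reflections do not see the sign of the
root. The right side depends on the product of the word alone. -/
theorem sum_deletions_smul {M : Type*} [AddCommGroup M] [Module ℂ M] (F : P.weylGroup → M) (x : V)
    (l : List b.support) :
    ((deletions b l).map fun y => P.toLinearMap x (P.coroot y.1) • F (wordProd b y.2)).sum =
      ∑ᶠ i ∈ inversions b (wordProd b l),
        P.toLinearMap x (P.coroot i) • F (wordProd b l * RootPairing.weylGroup.ofIdx P i) := by
  rw [← sum_deletions b (fun i =>
    P.toLinearMap x (P.coroot i) • F (wordProd b l * RootPairing.weylGroup.ofIdx P i))]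
  · congr 1
    refine List.map_congr_left fun y hy => ?_
    rw [wordProd_of_mem_deletions b hy]
  · intro i
    rw [coroot_opp, map_neg, neg_smul, ofIdx_opp]

/-- The composite of Demazure operators along a word depends only on the length and the product of
the word. -/
theorem demazureWord_congr {l l' : List b.support} (hlen : l.length = l'.length)
    (hprod : wordProd b l = wordProd b l') (f : SymmetricAlgebra ℂ V) :
    demazureWord b l f = demazureWord b l' f := by
  classical
  generalize hn : l.length = n
  induction n generalizing l l' f with
  | zero =>
    rw [List.length_eq_zero_iff.1 hn, List.length_eq_zero_iff.1 (hlen.symm.trans hn)]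
  | succ n ih =>
    -- By induction the composite along a shortened word is a function of its product, so the
    -- correction terms become a sum over inversions. The default value 0 is never taken at an
    -- actual deletion.
    have hsum : ∀ (m : List b.support) (x : V) (g : SymmetricAlgebra ℂ V), m.length = n + 1 →
        ((deletions b m).map fun y =>
          P.toLinearMap x (P.coroot y.1) • demazureWord b y.2 g).sum =
        ∑ᶠ i ∈ inversions b (wordProd b m), P.toLinearMap x (P.coroot i) •
          if h : ∃ k : List b.support, k.length = n ∧
            wordProd b k = wordProd b m * RootPairing.weylGroup.ofIdx P i then
            demazureWord b h.choose g else 0 := by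
      intro m x g hm
      rw [← sum_deletions_smul b (fun u => if h : ∃ k : List b.support, k.length = n ∧
            wordProd b k = u then demazureWord b h.choose g else 0)]
      congr 1
      refine List.map_congr_left fun y hy => ?_
      have hy' := length_of_mem_deletions b hy
      have hex : ∃ k : List b.support, k.length = n ∧ wordProd b k = wordProd b y.2 :=
        ⟨y.2, by omega, rfl⟩
      rw [dif_pos hex, ih (hex.choose_spec.1.trans (by omega)).symm hex.choose_spec.2.symm g
        (by omega)]
    -- Agreement of the two composites is propagated under multiplication by polynomials, starting
    -- from the constant 1, which both nonempty words kill.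
    have key : ∀ f g : SymmetricAlgebra ℂ V, demazureWord b l g = demazureWord b l' g →
        demazureWord b l (f * g) = demazureWord b l' (f * g) := by
      intro f
      induction f using SymmetricAlgebra.induction with
      | algebraMap c =>
        intro g hg
        rw [← Algebra.smul_def, demazureWord_smul, demazureWord_smul, hg]
      | ι x =>
        intro g hg
        rw [demazureWord_ι_mul, demazureWord_ι_mul, hsum l x g hn, hsum l' x g (hlen ▸ hn), hprod,
          hg]
      | mul f f' hf hf' =>
        intro g hg
        rw [mul_assoc]
        exact hf _ (hf' _ hg)
      | add f f' hf hf' =>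
        intro g hg
        rw [add_mul, demazureWord_add, demazureWord_add, hf _ hg, hf' _ hg]
    have h1 : l ≠ [] := by rintro rfl; simp at hn
    have h2 : l' ≠ [] := by rintro rfl; simp at hlen; exact h1 hlen
    have := key f (algebraMap ℂ _ 1) (by
      rw [demazureWord_algebraMap b h1, demazureWord_algebraMap b h2])
    rwa [map_one, mul_one] at this

/-- The composite of Demazure operators along a word that is not reduced vanishes. -/
theorem demazureWord_eq_zero {l : List b.support} (hl : weylLength b (wordProd b l) < l.length)
    (f : SymmetricAlgebra ℂ V) : demazureWord b l f = 0 := by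
  obtain ⟨n, hn⟩ := exists_padding b l
  obtain ⟨m, hm, hm'⟩ := exists_word b (wordProd b l)
  -- The excess is even and positive, so the word may be replaced by a reduced one padded with an
  -- even, positive number of copies of a single letter; $\Delta_s\Delta_s = 0$ finishes.
  obtain ⟨n, rfl⟩ : ∃ k, n = k + 1 := ⟨n - 1, by omega⟩
  obtain ⟨s, l', rfl⟩ : ∃ s l', l = s :: l' := List.exists_cons_of_length_pos (by omega)
  have hrep : wordProd b (List.replicate (2 * n) s) = 1 := by
    rw [wordProd, List.map_replicate, List.prod_replicate, pow_mul, pow_two,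
      simpleReflection_mul_self, one_pow]
  rw [demazureWord_congr b (l' := m ++ s :: s :: List.replicate (2 * n) s), demazureWord_append,
    demazureWord_cons, demazureWord_cons, demazure_demazure, demazureWord_zero]
  · simp only [List.length_append, List.length_cons, List.length_replicate] at hn ⊢
    omega
  · rw [wordProd_append, hm, wordProd_cons b s (s :: _), wordProd_cons b s (List.replicate _ _),
      hrep, mul_one, simpleReflection_mul_self, mul_one]

/-- Applying a Demazure operator for a reduced word to the power of a regular dominant weight whose
exponent is the length of the word gives a positive number. -/
theorem demazureWord_pow_pos {x : V}
    (hx : ∀ i, b.IsPos i → ∃ n : ℕ, 0 < n ∧ P.toLinearMap x (P.coroot i) = n)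
    (l : List b.support) :
    ∃ n : ℕ, SymmetricAlgebra.algebraMapInv
        (demazureWord b l (SymmetricAlgebra.ι ℂ V x ^ l.length)) = (n : ℂ) ∧
      (l.length = weylLength b (wordProd b l) → 0 < n) := by
  classical
  generalize hk : l.length = k
  induction k generalizing l with
  | zero =>
    rw [List.length_eq_zero_iff] at hk
    subst hk
    exact ⟨1, by simp, fun _ => one_pos⟩
  | succ k ih =>
    choose! N hN using hx
    choose! A hA hA' using ih
    -- The constant terms for words of length $k$, viewed as a function of the product. Single
    -- deletion terms can have negative coefficients; only after passing to inversions are all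
    -- coefficients positive.
    let F : P.weylGroup → ℕ := fun u => if h : ∃ m : List b.support, m.length = k ∧
      wordProd b m = u then A h.choose else 0
    have hF : ∀ m : List b.support, m.length = k →
        SymmetricAlgebra.algebraMapInv (demazureWord b m (SymmetricAlgebra.ι ℂ V x ^ k)) =
          (F (wordProd b m) : ℂ) := by
      intro m hm
      have hex : ∃ m' : List b.support, m'.length = k ∧ wordProd b m' = wordProd b m := ⟨m, hm, rfl⟩
      simp only [F]
      rw [dif_pos hex, ← hA _ hex.choose_spec.1,
        demazureWord_congr b (hex.choose_spec.1.trans hm.symm) hex.choose_spec.2]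
    have hF' : ∀ m : List b.support, m.length = k → k = weylLength b (wordProd b m) →
        0 < F (wordProd b m) := by
      intro m hm hred
      have hex : ∃ m' : List b.support, m'.length = k ∧ wordProd b m' = wordProd b m := ⟨m, hm, rfl⟩
      simp only [F]
      rw [dif_pos hex]
      refine hA' _ hex.choose_spec.1 ?_
      rw [hex.choose_spec.2]
      exact hred
    set S := (Set.toFinite (inversions b (wordProd b l))).toFinset with hS
    refine ⟨∑ i ∈ S, N i * F (wordProd b l * RootPairing.weylGroup.ofIdx P i), ?_, ?_⟩
    · rw [pow_succ', demazureWord_ι_mul, map_add, map_mul, SymmetricAlgebra.algebraMapInv_ι,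
        zero_mul, zero_add, map_list_sum, List.map_map]
      have : ((deletions b l).map (⇑(SymmetricAlgebra.algebraMapInv (R := ℂ) (M := V)) ∘ fun y =>
          P.toLinearMap x (P.coroot y.1) • demazureWord b y.2 (SymmetricAlgebra.ι ℂ V x ^ k))) =
          ((deletions b l).map fun y => P.toLinearMap x (P.coroot y.1) •
            (F (wordProd b y.2) : ℂ)) := by
        refine List.map_congr_left fun y hy => ?_
        have hy' := length_of_mem_deletions b hy
        rw [Function.comp_apply, map_smul, hF _ (by omega)]
      rw [this, sum_deletions_smul b (fun u => (F u : ℂ)),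
        finsum_mem_eq_finite_toFinset_sum _ (Set.toFinite _), ← hS, Nat.cast_sum]
      refine Finset.sum_congr rfl fun i hi => ?_
      rw [hS, Set.Finite.mem_toFinset] at hi
      rw [(hN i hi.1).2, Nat.cast_mul, smul_eq_mul]
    · intro hred
      -- Deleting the first letter of a reduced word leaves a reduced word and belongs to a genuine
      -- inversion, so its summand is strictly positive.
      obtain ⟨s, l', rfl⟩ : ∃ s l', l = s :: l' := List.exists_cons_of_length_pos (by omega)
      rw [← hk] at hred
      have hp := isPos_of_reduced b hred
      have hmem : P.weylGroupToPerm (wordProd b l')⁻¹ s ∈ inversions b (wordProd b (s :: l')) := by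
        rw [wordProd_cons, inversions_simple_mul_of_pos b s _ hp]
        exact Set.mem_insert _ _
      have hprod : wordProd b (s :: l') *
          RootPairing.weylGroup.ofIdx P (P.weylGroupToPerm (wordProd b l')⁻¹ s) =
          wordProd b l' :=
        (wordProd_of_mem_deletions b (l := s :: l') List.mem_cons_self).symm
      have htail := tail_reduced b hred
      rw [List.length_cons] at hk
      refine Finset.sum_pos' (fun _ _ => Nat.zero_le _) ⟨_, (Set.Finite.mem_toFinset _).2 hmem, ?_⟩
      rw [hprod]
      exact Nat.mul_pos (hN _ hp).1 (hF' l' (by omega) (by omega))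

end Demazure

end Coinvariant

namespace Coinvariant
open GradedRep

/-! ### Antisymmetric polynomials and divisibility by $\mu_J$. -/

section Top

variable {ι : Type*} {V : Type u} {V' : Type*} [AddCommGroup V] [Module ℂ V] [AddCommGroup V']
  [Module ℂ V'] {P : RootPairing ι ℂ V V'} (b : P.Base) (J : Set b.support)

theorem exists_of_mem_deletions {l : List b.support} (hl : ∀ t ∈ l, t ∈ J)
    {x : ι × List b.support} (hx : x ∈ deletions b l) :
    ∃ w ∈ parabolic b J, ∃ t ∈ J, x.1 = P.weylGroupToPerm w t := by
  induction l generalizing x with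
  | nil => simp [deletions] at hx
  | cons s l ih =>
    have hl' : ∀ t ∈ l, t ∈ J := fun t ht => hl t (by simp [ht])
    rw [deletions, List.mem_cons, List.mem_map] at hx
    rcases hx with rfl | ⟨y, hy, rfl⟩
    · exact ⟨_, inv_mem (wordProd_mem_parabolic b J hl'), s, hl s (by simp), rfl⟩
    · exact ih hl' (x := y) hy

theorem symAct_eq_or_neg_of_antisymm {f : SymmetricAlgebra ℂ V}
    (hf : ∀ s ∈ J, symAct P (simpleReflection b s) f = - f) {w : P.weylGroup}
    (hw : w ∈ parabolic b J) : symAct P w f = f ∨ symAct P w f = - f := by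
  obtain ⟨l, hl, rfl⟩ := exists_word_of_mem_parabolic b J hw
  clear hw
  induction l with
  | nil => left; rw [wordProd_nil, map_one]; rfl
  | cons s l ih =>
    rw [wordProd_cons, symAct_mul_apply]
    have hs := hf s (hl s (by simp))
    rcases ih fun t ht => hl t (by simp [ht]) with h | h
    · right; rw [h, hs]
    · left; rw [h, map_neg, hs, neg_neg]

/-- For $t \in J$ antisymmetry gives $2f = f - tf = \alpha_t\Delta_t f$. Applying $w$, which sends
$f$ to $\pm f$, moves the divisor to $w\alpha_t$. -/
theorem ι_dvd_of_antisymm {f : SymmetricAlgebra ℂ V}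
    (hf : ∀ s ∈ J, symAct P (simpleReflection b s) f = - f) {w : P.weylGroup}
    (hw : w ∈ parabolic b J) {t : b.support} (ht : t ∈ J) :
    SymmetricAlgebra.ι ℂ V (P.root (P.weylGroupToPerm w t)) ∣ f := by
  have h1 : SymmetricAlgebra.ι ℂ V (P.root t) ∣ f := by
    refine ⟨(2⁻¹ : ℂ) • demazure b t f, ?_⟩
    rw [mul_smul_comm, ← demazure_spec, hf t ht, sub_neg_eq_add, ← two_smul ℂ f, smul_smul]
    norm_num
  have h2 := map_dvd (symAct P w) h1
  rw [symAct_ι, smul_root] at h2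
  rcases symAct_eq_or_neg_of_antisymm b J hf hw with h | h
  · rwa [h] at h2
  · rwa [h, dvd_neg] at h2

theorem prod_ι_mem_symDeg (S : Finset ι) :
    ∏ i ∈ S, SymmetricAlgebra.ι ℂ V (P.root i) ∈ symDeg ℂ V (2 * (S.card : ℤ)) := by
  classical
  induction S using Finset.induction_on with
  | empty => simpa using one_mem_symDeg (K := ℂ) (V := V)
  | insert i S hi ih =>
    rw [Finset.prod_insert hi, Finset.card_insert_of_notMem hi]
    have := mul_mem_symDeg 2 _ _ (ι_mem_symDeg (P.root i)) _ ih
    convert this using 2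
    push_cast
    ring

theorem weylSign_mul_self (w : P.weylGroup) : weylSign b w * weylSign b w = 1 := by
  rw [weylSign, ← mul_pow]; norm_num

theorem ι_pow_mem_symDeg (x : V) (n : ℕ) :
    SymmetricAlgebra.ι ℂ V x ^ n ∈ symDeg ℂ V (2 * (n : ℤ)) :=
  pow_le_symDeg n (Submodule.pow_mem_pow _ (LinearMap.mem_range_self _ x) n)

/-- Distinct positive roots of a reduced system are not proportional, so they are non-associated
primes. -/
theorem prod_ι_dvd [P.IsReduced] {f : SymmetricAlgebra ℂ V} (S : Finset ι) (hS : ∀ i ∈ S, b.IsPos i)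
    (h : ∀ i ∈ S, SymmetricAlgebra.ι ℂ V (P.root i) ∣ f) :
    ∏ i ∈ S, SymmetricAlgebra.ι ℂ V (P.root i) ∣ f := by
  classical
  induction S using Finset.induction_on with
  | empty => simp
  | insert i S hi ih =>
    obtain ⟨g, rfl⟩ := ih (fun j hj => hS j (Finset.mem_insert_of_mem hj))
      fun j hj => h j (Finset.mem_insert_of_mem hj)
    have hp : Prime (SymmetricAlgebra.ι ℂ V (P.root i)) := prime_ι (P.ne_zero i)
    rcases hp.dvd_or_dvd (h i (Finset.mem_insert_self i S)) with h1 | h1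
    · exfalso
      obtain ⟨j, hj, h2⟩ := (hp.dvd_finsetProd_iff _).1 h1
      refine not_ι_dvd_ι ?_ h2
      have hij : i ≠ j := fun h' => hi (h' ▸ hj)
      have hne : P.root i ≠ - P.root j := by
        intro h'
        rw [← root_opp] at h'
        have := P.root.injective h'
        have hpi := hS i (Finset.mem_insert_self i S)
        rw [this, isPos_opp] at hpi
        exact hpi (hS j (Finset.mem_insert_of_mem hj))
      have hli := (LinearIndependent.pair_iff' (P.ne_zero i)).1
        (RootPairing.IsReduced.linearIndependent P hij hne)
      rw [Submodule.mem_span_singleton]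
      rintro ⟨a, ha⟩
      exact hli a ha
    · rw [Finset.prod_insert hi, mul_comm]
      exact mul_dvd_mul_left _ h1

variable [Finite ι] [P.IsCrystallographic] [P.IsReduced] [P.IsRootSystem]

theorem rootProd_eq_prod :
    ∃ S : Finset ι, (∀ i, i ∈ S ↔ b.IsPos i ∧ i ∈ parabolicRoots b J) ∧
      S.card = weylLength b (longest b J) ∧
      rootProd b J = ∏ i ∈ S, SymmetricAlgebra.ι ℂ V (P.root i) := by
  refine ⟨(Set.toFinite {i | b.IsPos i ∧ i ∈ parabolicRoots b J}).toFinset, fun i => ?_, ?_, ?_⟩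
  · rw [Set.Finite.mem_toFinset]; rfl
  · rw [weylLength_longest, Set.ncard_eq_toFinset_card _ (Set.toFinite _)]
  · exact finprod_mem_eq_finite_toFinset_prod _ (Set.toFinite _)

theorem rootProd_mem_symDeg :
    rootProd b J ∈ symDeg ℂ V (2 * (weylLength b (longest b J) : ℤ)) := by
  obtain ⟨S, -, hS, h⟩ := rootProd_eq_prod b J
  rw [h, ← hS]
  exact prod_ι_mem_symDeg S

theorem rootProd_ne_zero : rootProd b J ≠ 0 := by
  obtain ⟨S, -, -, h⟩ := rootProd_eq_prod b J
  rw [h]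
  exact Finset.prod_ne_zero_iff.2 fun i _ => ι_root_ne_zero i

/-- A polynomial that is antisymmetric under `W_J` is divisible by `μ_J`. -/
theorem rootProd_dvd_of_antisymm {f : SymmetricAlgebra ℂ V}
    (hf : ∀ s ∈ J, symAct P (simpleReflection b s) f = - f) : rootProd b J ∣ f := by
  obtain ⟨S, hS, -, h⟩ := rootProd_eq_prod b J
  rw [h]
  refine prod_ι_dvd b S (fun i hi => ((hS i).1 hi).1) fun i hi => ?_
  -- Every root in $\Phi_J^+$ is an inversion of $w_J$, hence up to sign a deletion root of a word
  -- in $J$, hence up to sign $W_J$-conjugate to a simple root in $J$.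
  have hinv : i ∈ inversions b (longest b J) := by
    rw [inversions_longest]; exact (hS i).1 hi
  obtain ⟨l, hl, hlw⟩ := exists_word_of_mem_parabolic b J (longest_mem b J)
  rw [← hlw] at hinv
  obtain ⟨x, hx, hxi⟩ := exists_deletion_of_mem_inversions b hinv
  obtain ⟨w, hw, t, ht, hxw⟩ := exists_of_mem_deletions b J hl hx
  have := ι_dvd_of_antisymm b J hf hw ht
  rcases hxi with rfl | rfl
  · rwa [hxw]
  · rwa [root_opp, map_neg, neg_dvd, hxw]

/-! ### The Demazure operator of the longest element -/

/-- A reduced word of the longest element of `W_J`. -/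
noncomputable def longestWord : List b.support := (exists_word b (longest b J)).choose

theorem wordProd_longestWord : wordProd b (longestWord b J) = longest b J :=
  (exists_word b (longest b J)).choose_spec.1

theorem length_longestWord : (longestWord b J).length = weylLength b (longest b J) :=
  (exists_word b (longest b J)).choose_spec.2

theorem mem_of_mem_longestWord {t : b.support} (ht : t ∈ longestWord b J) : t ∈ J := by
  refine mem_of_mem_reduced b J ?_ ?_ ht
  · rw [length_longestWord, wordProd_longestWord]
  · rw [wordProd_longestWord]; exact longest_mem b J

/-- The Demazure operator of the longest element of `W_J`. -/
noncomputable def demazureTop : SymmetricAlgebra ℂ V →ₗ[ℂ] SymmetricAlgebra ℂ V :=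
  demazureLinear b (longestWord b J)

variable {J}

theorem demazureWord_eq_zero_of_length {l : List b.support} (hl : ∀ t ∈ l, t ∈ J)
    (hlen : weylLength b (longest b J) < l.length) (f : SymmetricAlgebra ℂ V) :
    demazureWord b l f = 0 :=
  demazureWord_eq_zero b
    ((weylLength_le_longest b J (wordProd_mem_parabolic b J hl)).trans_lt hlen) f

theorem demazureWord_eq_zero_of_ne {l : List b.support} (hl : ∀ t ∈ l, t ∈ J)
    (hlen : l.length = weylLength b (longest b J)) (hne : wordProd b l ≠ longest b J)
    (f : SymmetricAlgebra ℂ V) : demazureWord b l f = 0 := by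
  have hmem := wordProd_mem_parabolic b J hl
  refine demazureWord_eq_zero b (lt_of_le_of_ne (weylLength_le b l) fun h => hne ?_) f
  exact eq_longest b J hmem (h.trans hlen)

theorem demazureWord_eq_top {l : List b.support} (hlen : l.length = weylLength b (longest b J))
    (hprod : wordProd b l = longest b J) (f : SymmetricAlgebra ℂ V) :
    demazureWord b l f = demazureTop b J f :=
  demazureWord_congr b (hlen.trans (length_longestWord b J).symm)
    (hprod.trans (wordProd_longestWord b J).symm) f

/-- The word with $s$ prepended is longer than any reduced word in $W_J$. -/
theorem demazure_demazureTop {s : b.support} (hs : s ∈ J) (f : SymmetricAlgebra ℂ V) :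
    demazure b s (demazureTop b J f) = 0 := by
  refine demazureWord_eq_zero_of_length b (J := J) (l := s :: longestWord b J) ?_ ?_ f
  · intro t ht
    rcases List.mem_cons.1 ht with rfl | ht
    · exact hs
    · exact mem_of_mem_longestWord b J ht
  · rw [List.length_cons, length_longestWord]; omega

theorem symAct_demazureTop {w : P.weylGroup} (hw : w ∈ parabolic b J) (f : SymmetricAlgebra ℂ V) :
    symAct P w (demazureTop b J f) = demazureTop b J f := by
  obtain ⟨l, hl, rfl⟩ := exists_word_of_mem_parabolic b J hw
  clear hw
  induction l with
  | nil => rw [wordProd_nil, map_one]; rfl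
  | cons s l ih =>
    rw [wordProd_cons, symAct_mul_apply, ih fun t ht => hl t (by simp [ht])]
    exact (demazure_eq_zero_iff b s _).1 (demazure_demazureTop b (hl s (by simp)) f)

/-- Since $\ell(w_J s) = \ell(w_J) - 1$, a reduced word of $w_J$ can be chosen to end in $s$. -/
theorem exists_demazureTop_eq {s : b.support} (hs : s ∈ J) :
    ∃ l : List b.support, ∀ f, demazureTop b J f = demazureWord b l (demazure b s f) := by
  obtain ⟨l, hl, hl'⟩ := exists_word b (longest b J * simpleReflection b s)
  refine ⟨l, fun f => ?_⟩
  have h1 := weylLength_longest_mul b J (simpleReflection_mem_parabolic b J hs)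
  have h2 : weylLength b (simpleReflection b s) = 1 := by
    have := weylLength_simple_mul_of_pos b s 1 (by simpa using isPos_simple b s)
    rwa [mul_one, weylLength_one] at this
  have h3 := demazureWord_eq_top b (J := J) (l := l ++ [s])
    (by rw [List.length_append, List.length_singleton]; omega)
    (by rw [wordProd_append, hl, wordProd_cons, wordProd_nil, mul_one, mul_assoc,
      simpleReflection_mul_self, mul_one]) f
  rw [← h3, demazureWord_append]
  rfl

/-- Self-adjointness of $\Delta_s$: both products have the image $\Delta_s f\cdot\Delta_s g$ under
$\Delta_s$, through which $\Delta_{w_J}$ factors. -/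
theorem demazureTop_demazure_mul {s : b.support} (hs : s ∈ J) (f g : SymmetricAlgebra ℂ V) :
    demazureTop b J (demazure b s f * g) = demazureTop b J (f * demazure b s g) := by
  obtain ⟨l, hl⟩ := exists_demazureTop_eq b hs
  rw [hl, hl, demazure_mul, demazure_mul, demazure_demazure, demazure_demazure, symAct_demazure]
  simp

theorem demazureTop_demazureWord_mul {l : List b.support} (hl : ∀ t ∈ l, t ∈ J)
    (f g : SymmetricAlgebra ℂ V) :
    demazureTop b J (demazureWord b l f * g) =
      demazureTop b J (f * demazureWord b l.reverse g) := by
  induction l generalizing g with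
  | nil => rfl
  | cons s l ih =>
    rw [demazureWord_cons, demazureTop_demazure_mul b (hl s (by simp)),
      ih fun t ht => hl t (by simp [ht]), List.reverse_cons, demazureWord_append]
    rfl

/-- Letter by letter, from $\Delta_s(sf) = -\Delta_s f$ and the factorisation of $\Delta_{w_J}$
through $\Delta_s$. -/
theorem demazureTop_symAct {w : P.weylGroup} (hw : w ∈ parabolic b J) (f : SymmetricAlgebra ℂ V) :
    demazureTop b J (symAct P w f) = weylSign b w • demazureTop b J f := by
  obtain ⟨l, hl, rfl⟩ := exists_word_of_mem_parabolic b J hw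
  clear hw
  induction l with
  | nil =>
    rw [wordProd_nil, map_one, weylSign, weylLength_one, pow_zero, one_smul]; rfl
  | cons s l ih =>
    obtain ⟨m, hm⟩ := exists_demazureTop_eq b (hl s (by simp))
    rw [wordProd_cons, symAct_mul_apply, weylSign_simple_mul, neg_smul,
      ← ih fun t ht => hl t (by simp [ht]), hm, hm, demazure_symAct, ← neg_one_smul ℂ,
      demazureWord_smul, neg_one_smul]

theorem demazureTop_mem_symDeg {d : ℤ} {f : SymmetricAlgebra ℂ V} (hf : f ∈ symDeg ℂ V d) :
    demazureTop b J f ∈ symDeg ℂ V (d - 2 * (weylLength b (longest b J) : ℤ)) := by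
  rw [← length_longestWord]
  exact demazureWord_mem_symDeg b _ hf

variable (J)

/-- The Demazure operator of the longest element of `W_J` maps `μ_J` to a nonzero constant. -/
theorem exists_demazureTop_rootProd :
    ∃ c : ℂ, c ≠ 0 ∧ demazureTop b J (rootProd b J) = algebraMap ℂ _ c := by
  classical
  have : Fintype (parabolic b J) := Fintype.ofFinite _
  obtain ⟨x, hx⟩ := exists_regular_weight b
  set g := SymmetricAlgebra.ι ℂ V x ^ (longestWord b J).length with hg
  have hgd : g ∈ symDeg ℂ V (2 * (weylLength b (longest b J) : ℤ)) := by
    rw [hg, length_longestWord]; exact ι_pow_mem_symDeg x _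
  have hDg : demazureTop b J g ≠ 0 := by
    intro h0
    obtain ⟨n, hn, hn'⟩ := demazureWord_pow_pos b hx (longestWord b J)
    have h1 := hn' (by rw [length_longestWord, wordProd_longestWord])
    change SymmetricAlgebra.algebraMapInv (demazureTop b J g) = _ at hn
    rw [h0, map_zero] at hn
    have : n = 0 := by exact_mod_cast hn.symm
    omega
  -- The antisymmetrisation of $g$ has image $|W_J|\,\Delta_{w_J}g \neq 0$, and by degree it is a
  -- constant multiple of $\mu_J$. So $\Delta_{w_J}\mu_J$ cannot vanish.
  set f := ∑ w : parabolic b J, weylSign b w.1 • symAct P w.1 g with hf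
  have hfd : f ∈ symDeg ℂ V (2 * (weylLength b (longest b J) : ℤ)) :=
    sum_mem fun w _ => Submodule.smul_mem _ _ (symAct_mem_symDeg _ hgd)
  have hanti : ∀ s ∈ J, symAct P (simpleReflection b s) f = - f := by
    intro s hs
    rw [hf, map_sum, ← Finset.sum_neg_distrib]
    refine Fintype.sum_equiv (Equiv.mulLeft
      (⟨_, simpleReflection_mem_parabolic b J hs⟩ : parabolic b J)) _ _ fun w => ?_
    rw [map_smul, ← symAct_mul_apply, Equiv.coe_mulLeft, Subgroup.coe_mul, weylSign_simple_mul,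
      neg_smul, neg_neg]
  have hDf : demazureTop b J f = (Fintype.card (parabolic b J) : ℂ) • demazureTop b J g := by
    rw [hf, map_sum]
    simp only [map_smul, demazureTop_symAct b (Subtype.prop _), smul_smul, weylSign_mul_self,
      one_smul]
    rw [Finset.sum_const, Finset.card_univ, Nat.cast_smul_eq_nsmul]
  obtain ⟨q, hq⟩ := rootProd_dvd_of_antisymm b J hanti
  have hqd := mem_symDeg_of_mul_mem (rootProd_mem_symDeg b J) (rootProd_ne_zero b J) (hq ▸ hfd)
  rw [sub_self] at hqd
  obtain ⟨a, rfl⟩ := symDeg_zero hqd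
  have hμ := demazureTop_mem_symDeg b (J := J) (rootProd_mem_symDeg b J)
  rw [sub_self] at hμ
  obtain ⟨c, hc⟩ := symDeg_zero hμ
  refine ⟨c, fun h0 => ?_, hc⟩
  rw [hq, mul_comm, ← Algebra.smul_def, map_smul, hc, h0, map_zero, smul_zero] at hDf
  refine hDg ((smul_eq_zero.1 hDf.symm).resolve_left ?_)
  exact_mod_cast Fintype.card_ne_zero

end Top

end Coinvariant

namespace Coinvariant
open GradedRep

/-! ### Dual bases for a linear form -/

section DualBasis

variable {A B : Type*} [CommRing A] [CommRing B] [Algebra A B] {I : Type*} [Fintype I]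
  [DecidableEq I]

/-- Take $y = G^{-1}z$ for the Gram matrix $G$. The error $f - \sum_w D(y_w f)x_w$ is orthogonal to
every $z_u$, so separation replaces a spanning hypothesis. -/
theorem exists_dual_basis (D : B →ₗ[A] A) (x z : I → B)
    (hG : IsUnit (Matrix.of fun u w => D (z u * x w)).det)
    (hsep : ∀ f, (∀ u, D (z u * f) = 0) → f = 0) :
    ∃ y : I → B, (∀ u w, D (y u * x w) = if u = w then 1 else 0) ∧
      ∀ f, f = ∑ w, D (y w * f) • x w := by
  set G : Matrix I I A := Matrix.of fun u w => D (z u * x w) with hGdef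
  refine ⟨fun u => ∑ v, G⁻¹ u v • z v, fun u w => ?_, fun f => ?_⟩
  · have := congrFun (congrFun (Matrix.nonsing_inv_mul G hG) u) w
    rw [Matrix.mul_apply, Matrix.one_apply] at this
    rw [← this, Finset.sum_mul, map_sum]
    refine Finset.sum_congr rfl fun v _ => ?_
    rw [smul_mul_assoc, map_smul, smul_eq_mul]
    rfl
  · rw [← sub_eq_zero]
    refine hsep _ fun u => ?_
    have h1 : ∀ w, D ((∑ v, G⁻¹ w v • z v) * f) = ∑ v, G⁻¹ w v * D (z v * f) := fun w => by
      rw [Finset.sum_mul, map_sum]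
      refine Finset.sum_congr rfl fun v _ => ?_
      rw [smul_mul_assoc, map_smul, smul_eq_mul]
    rw [mul_sub, map_sub, Finset.mul_sum, map_sum, sub_eq_zero]
    simp only [h1, mul_smul_comm, map_smul, smul_eq_mul]
    have h2 : ∀ w, D (z u * x w) = G u w := fun w => rfl
    have h3 : G.mulVec (G⁻¹.mulVec fun v => D (z v * f)) = fun v => D (z v * f) := by
      rw [Matrix.mulVec_mulVec, Matrix.mul_nonsing_inv G hG, Matrix.one_mulVec]
    have h4 := congrFun h3 u
    rw [← h4]
    simp only [Matrix.mulVec, dotProduct, h2]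
    refine Finset.sum_congr rfl fun w _ => mul_comm _ _

end DualBasis

/-! ### Demazure operators on the coinvariant algebra and the form $\Delta_{w_J}$. -/

section Coinv

variable {ι : Type*} {V : Type u} {V' : Type*} [AddCommGroup V] [Module ℂ V] [AddCommGroup V']
  [Module ℂ V'] {P : RootPairing ι ℂ V V'} (b : P.Base) (J : Set b.support)

/-- The generators are invariant, hence killed, and the twisted Leibniz rule handles their
multiples. -/
theorem demazure_mem_coinvIdeal (s : b.support) {f : SymmetricAlgebra ℂ V}
    (hf : f ∈ coinvIdeal P) : demazure b s f ∈ coinvIdeal P := by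
  induction hf using Submodule.span_induction with
  | mem f hf =>
    rw [(demazure_eq_zero_iff b s f).2 (hf.2 _)]
    exact zero_mem _
  | zero => rw [(demazure_eq_zero_iff b s 0).2 (map_zero _)]; exact zero_mem _
  | add f g _ _ hf hg => rw [demazure_add]; exact add_mem hf hg
  | smul a f hf' hf =>
    rw [smul_eq_mul, demazure_mul]
    exact add_mem (Ideal.mul_mem_left _ _ hf') (Ideal.mul_mem_left _ _ hf)

/-- The Demazure operator on the coinvariant algebra. -/
noncomputable def coinvDemazure (s : b.support) : CoinvAlg P →+ CoinvAlg P :=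
  QuotientAddGroup.map _ _ (demazureLinear b [s]).toAddMonoidHom
    fun _ hx => demazure_mem_coinvIdeal b s hx

theorem coinvDemazure_mk (s : b.support) (f : SymmetricAlgebra ℂ V) :
    coinvDemazure b s (Ideal.Quotient.mk (coinvIdeal P) f) =
      Ideal.Quotient.mk (coinvIdeal P) (demazure b s f) := rfl

theorem coinvAct_mk (w : P.weylGroup) (f : SymmetricAlgebra ℂ V) :
    coinvAct P w (Ideal.Quotient.mk (coinvIdeal P) f) =
      Ideal.Quotient.mk (coinvIdeal P) (symAct P w f) := rfl

theorem coinvAct_mul_apply (w w' : P.weylGroup) (x : CoinvAlg P) :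
    coinvAct P (w * w') x = coinvAct P w (coinvAct P w' x) := by
  rw [map_mul]; rfl

/-- An $s$-invariant class lifts to an $s$-invariant polynomial, the average $(f + sf)/2$ of any
lift $f$. -/
theorem coinvDemazure_mul {s : b.support} {a : CoinvAlg P}
    (ha : coinvAct P (simpleReflection b s) a = a) (x : CoinvAlg P) :
    coinvDemazure b s (a * x) = a * coinvDemazure b s x := by
  obtain ⟨f, rfl⟩ := Ideal.Quotient.mk_surjective a
  obtain ⟨g, rfl⟩ := Ideal.Quotient.mk_surjective x
  set f' := (2⁻¹ : ℂ) • (f + symAct P (simpleReflection b s) f) with hf'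
  have h1 : symAct P (simpleReflection b s) f' = f' := by
    rw [hf', map_smul, map_add, symAct_simple_simple, add_comm]
  have h2 : Ideal.Quotient.mk (coinvIdeal P) f' = Ideal.Quotient.mk (coinvIdeal P) f := by
    change Ideal.Quotient.mkₐ ℂ (coinvIdeal P) f' = Ideal.Quotient.mkₐ ℂ (coinvIdeal P) f
    rw [hf', map_smul, map_add]
    change (2⁻¹ : ℂ) • (Ideal.Quotient.mk (coinvIdeal P) f +
      coinvAct P (simpleReflection b s) (Ideal.Quotient.mk (coinvIdeal P) f)) = _
    rw [ha, ← two_smul ℂ, smul_smul]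
    norm_num
  rw [← h2, ← map_mul, coinvDemazure_mk, coinvDemazure_mk, demazure_invariant_mul b h1, map_mul]

theorem coinvAct_eq_of_coinvDemazure {s : b.support} {x : CoinvAlg P}
    (h : coinvDemazure b s x = 0) : coinvAct P (simpleReflection b s) x = x := by
  obtain ⟨f, rfl⟩ := Ideal.Quotient.mk_surjective x
  have := congrArg (Ideal.Quotient.mk (coinvIdeal P)) (demazure_spec b s f)
  rw [map_mul, ← coinvDemazure_mk, h, mul_zero, map_sub, sub_eq_zero] at this
  exact this.symm

/-- The composite of Demazure operators on the coinvariant algebra along a word. -/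
noncomputable def coinvDemazureWord (l : List b.support) : CoinvAlg P →+ CoinvAlg P :=
  l.foldr (fun s φ => (coinvDemazure b s).comp φ) (AddMonoidHom.id _)

theorem coinvDemazureWord_cons (s : b.support) (l : List b.support) (x : CoinvAlg P) :
    coinvDemazureWord b (s :: l) x = coinvDemazure b s (coinvDemazureWord b l x) := rfl

theorem coinvDemazureWord_mk (l : List b.support) (f : SymmetricAlgebra ℂ V) :
    coinvDemazureWord b l (Ideal.Quotient.mk (coinvIdeal P) f) =
      Ideal.Quotient.mk (coinvIdeal P) (demazureWord b l f) := by
  induction l with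
  | nil => rfl
  | cons s l ih => rw [coinvDemazureWord_cons, ih, coinvDemazure_mk, demazureWord_cons]

theorem mem_coinvInv_of_simple {x : CoinvAlg P}
    (hx : ∀ s ∈ J, coinvAct P (simpleReflection b s) x = x) : x ∈ coinvInv b J := by
  intro w hw
  obtain ⟨l, hl, rfl⟩ := exists_word_of_mem_parabolic b J hw
  clear hw
  induction l with
  | nil => rw [wordProd_nil, map_one]; rfl
  | cons s l ih =>
    rw [wordProd_cons, coinvAct_mul_apply, ih fun t ht => hl t (by simp [ht]), hx s (hl s (by simp))]

theorem coinvDemazureWord_mul {l : List b.support} (hl : ∀ t ∈ l, t ∈ J) {a : CoinvAlg P}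
    (ha : a ∈ coinvInv b J) (x : CoinvAlg P) :
    coinvDemazureWord b l (a * x) = a * coinvDemazureWord b l x := by
  induction l with
  | nil => rfl
  | cons s l ih =>
    rw [coinvDemazureWord_cons, ih fun t ht => hl t (by simp [ht]), coinvDemazureWord_cons,
      coinvDemazure_mul b (ha _ (simpleReflection_mem_parabolic b J (hl s (by simp))))]

/-- The `C^J`-algebra structure of `C`. -/
noncomputable abbrev coinvAlgebra : Algebra (coinvInv b J) (CoinvAlg P) := (coinvInv b J).toAlgebra

/-- The `C^J`-module structure of `C`. -/
noncomputable abbrev coinvModule : Module (coinvInv b J) (CoinvAlg P) :=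
  (coinvAlgebra b J).toModule

variable [Finite ι] [P.IsCrystallographic] [P.IsReduced] [P.IsRootSystem]

attribute [local instance] coinvAlgebra coinvModule

/-- The Demazure operator of the longest element of `W_J`, as a `C^J`-linear map `C → C^J`. -/
noncomputable def coinvTop : CoinvAlg P →ₗ[coinvInv b J] coinvInv b J where
  toFun x := ⟨coinvDemazureWord b (longestWord b J) x, by
    obtain ⟨f, rfl⟩ := Ideal.Quotient.mk_surjective x
    intro w hw
    rw [coinvDemazureWord_mk, coinvAct_mk]
    exact congrArg _ (symAct_demazureTop b hw f)⟩
  map_add' x y := Subtype.ext (map_add (coinvDemazureWord b (longestWord b J)) x y)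
  map_smul' a x := Subtype.ext
    (coinvDemazureWord_mul b J (fun _ => mem_of_mem_longestWord b J) a.2 x)

theorem coinvTop_mk (f : SymmetricAlgebra ℂ V) :
    (coinvTop b J (Ideal.Quotient.mk (coinvIdeal P) f) : CoinvAlg P) =
      Ideal.Quotient.mk (coinvIdeal P) (demazureTop b J f) :=
  coinvDemazureWord_mk b _ f

theorem coinvTop_mem {d : ℤ} {x : CoinvAlg P} (hx : x ∈ coinvDeg P d) :
    coinvTop b J x ∈ coinvInvDeg b J (d - 2 * (weylLength b (longest b J) : ℤ)) := by
  obtain ⟨f, hf, rfl⟩ := hx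
  exact ⟨demazureTop b J f, demazureTop_mem_symDeg b hf, (coinvTop_mk b J f).symm⟩

theorem coinvTop_rootProd_mul :
    ∃ c : ℂ, c ≠ 0 ∧ ∀ a ∈ coinvInv b J,
      (coinvTop b J (Ideal.Quotient.mk (coinvIdeal P) (rootProd b J) * a) : CoinvAlg P) =
        c • a := by
  obtain ⟨c, hc, h⟩ := exists_demazureTop_rootProd b J
  refine ⟨c, hc, fun a ha => ?_⟩
  have h1 := (coinvTop b J).map_smul (⟨a, ha⟩ : coinvInv b J)
    (Ideal.Quotient.mk (coinvIdeal P) (rootProd b J))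
  have h2 : (⟨a, ha⟩ : coinvInv b J) • Ideal.Quotient.mk (coinvIdeal P) (rootProd b J) =
    Ideal.Quotient.mk (coinvIdeal P) (rootProd b J) * a := mul_comm _ _
  rw [← h2, h1]
  change a * (coinvTop b J (Ideal.Quotient.mk (coinvIdeal P) (rootProd b J)) : CoinvAlg P) = _
  rw [coinvTop_mk, h]
  exact (mul_comm _ _).trans (Algebra.smul_def c a).symm

theorem coinvTop_word_mul {l : List b.support} (hl : ∀ t ∈ l, t ∈ J) (f : SymmetricAlgebra ℂ V)
    (x : CoinvAlg P) :
    coinvTop b J (Ideal.Quotient.mk (coinvIdeal P) (demazureWord b l f) * x) =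
      coinvTop b J (Ideal.Quotient.mk (coinvIdeal P) f * coinvDemazureWord b l.reverse x) := by
  obtain ⟨g, rfl⟩ := Ideal.Quotient.mk_surjective x
  apply Subtype.ext
  rw [coinvDemazureWord_mk, ← map_mul, ← map_mul, coinvTop_mk, coinvTop_mk,
    demazureTop_demazureWord_mul b hl]

/-- The pairing `(x, y) ↦ Δ_{w_J}(xy)` separates points. -/
theorem eq_zero_of_coinvTop {red : parabolic b J → List b.support}
    (hred : ∀ w, IsReducedExpr b w.1 (red w)) {x : CoinvAlg P}
    (hx : ∀ w, coinvTop b J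
      (Ideal.Quotient.mk (coinvIdeal P) (demazureWord b (red w) (rootProd b J)) * x) = 0) :
    x = 0 := by
  obtain ⟨c, hc, hcμ⟩ := coinvTop_rootProd_mul b J
  obtain ⟨f, hf⟩ := Ideal.Quotient.mk_surjective x
  have hredJ : ∀ w, ∀ t ∈ red w, t ∈ J := fun w t ht =>
    mem_of_mem_reduced b J (by rw [(hred w).2, ← (hred w).1]; rfl)
      (by rw [show wordProd b (red w) = w.1 from (hred w).1]; exact w.2) ht
  -- Descending induction on the length of $l$: beyond $\ell(w_J)$ every composite vanishes, and the
  -- empty word gives $x = 0$.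
  suffices ∀ n : ℕ, ∀ l : List b.support, (∀ t ∈ l, t ∈ J) →
      weylLength b (longest b J) + 1 ≤ n + l.length → coinvDemazureWord b l x = 0 by
    exact this (weylLength b (longest b J) + 1) [] (by simp) (by simp)
  intro n
  induction n with
  | zero =>
    intro l hl hlen
    rw [← hf, coinvDemazureWord_mk, demazureWord_eq_zero_of_length b hl (by omega), map_zero]
  | succ n ih =>
    intro l hl hlen
    by_cases hlr : weylLength b (wordProd b l) < l.length
    · rw [← hf, coinvDemazureWord_mk, demazureWord_eq_zero b hlr, map_zero]
    · have hmem := wordProd_mem_parabolic b J hl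
      -- By induction $\Delta_s\Delta_l x = 0$ for $s \in J$, so $\Delta_l x$ is $W_J$-invariant.
      -- Pairing $x$ with $\Delta_u\mu_J$ for this $u$ then gives $\Delta_{w_J}(\mu_J\cdot\Delta_l
      -- x) = c\,\Delta_l x$.
      let u : parabolic b J := ⟨(wordProd b l)⁻¹, inv_mem hmem⟩
      have hu : wordProd b (red u).reverse = wordProd b l := by
        rw [wordProd_reverse, show wordProd b (red u) = u.1 from (hred u).1, inv_inv]
      have hlu : (red u).reverse.length = l.length := by
        rw [List.length_reverse, (hred u).2, weylLength_inv]
        exact le_antisymm (weylLength_le b l) (not_lt.1 hlr)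
      have h1 := hx u
      rw [coinvTop_word_mul b J (hredJ u)] at h1
      have h2 : coinvDemazureWord b (red u).reverse x = coinvDemazureWord b l x := by
        rw [← hf, coinvDemazureWord_mk, coinvDemazureWord_mk, demazureWord_congr b hlu hu]
      rw [h2] at h1
      have h3 : coinvDemazureWord b l x ∈ coinvInv b J := by
        refine mem_coinvInv_of_simple b J fun s hs => coinvAct_eq_of_coinvDemazure b ?_
        rw [← coinvDemazureWord_cons]
        refine ih _ (fun t ht => ?_) (by rw [List.length_cons]; omega)
        rcases List.mem_cons.1 ht with rfl | ht
        · exact hs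
        · exact hl t ht
      have h4 := hcμ _ h3
      rw [h1] at h4
      exact (smul_eq_zero.1 h4.symm).resolve_left hc

end Coinv

end Coinvariant

namespace Coinvariant
open GradedRep

/-! ### Homogeneous dual bases. -/

section Homogeneous

variable {K A B : Type*} [Field K] [CommRing A] [CommRing B] [Algebra K B]
  [Algebra A B] {I : Type*} [Fintype I] [DecidableEq I] {ℬ : ℤ → Submodule K B}

/-- A dual basis of a homogeneous basis with respect to a homogeneous linear form can be chosen
homogeneous. -/
theorem exists_homogeneous_dual_basis (hinj : Function.Injective (algebraMap A B))
    (hℬ : DirectSum.IsInternal ℬ) (hmul : ∀ i j, ∀ x ∈ ℬ i, ∀ y ∈ ℬ j, x * y ∈ ℬ (i + j))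
    (hone : 1 ∈ ℬ 0) (D : B →ₗ[A] A) (N : ℤ)
    (hD : ∀ d, ∀ x ∈ ℬ d, algebraMap A B (D x) ∈ ℬ (d - N))
    {x y : I → B} {e : I → ℤ} (hx : ∀ w, x w ∈ ℬ (N - e w))
    (hy : ∀ u w, D (y u * x w) = if u = w then 1 else 0)
    (hy' : ∀ f, f = ∑ w, D (y w * f) • x w) :
    ∃ z : I → B, (∀ w, z w ∈ ℬ (e w)) ∧ (∀ u w, D (z u * x w) = if u = w then 1 else 0) ∧
      ∀ f, f = ∑ w, D (z w * f) • x w := by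
  obtain ⟨p, hpm, hpi, hp0, hps⟩ := exists_proj hℬ
  have hpX : ∀ k d a f, f ∈ ℬ d → p k a * f = p (k + d) (a * f) := by
    intro k d a f hf
    obtain ⟨s, hs⟩ := hps a
    rw [hs, Finset.sum_mul, map_sum, map_sum, Finset.sum_mul]
    refine Finset.sum_congr rfl fun i _ => ?_
    have hm := hmul i d _ (hpm i a) f hf
    by_cases hk : k = i
    · rw [hk, hpi _ _ hm, hpi _ _ (hpm i a)]
    · rw [hp0 _ _ hk _ (hpm i a), hp0 _ _ (by omega) _ hm, zero_mul]
  have hpD : ∀ k x, algebraMap A B (D (p k x)) = p (k - N) (algebraMap A B (D x)) := by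
    intro k x
    obtain ⟨s, hs⟩ := hps x
    rw [hs, map_sum, map_sum, map_sum, map_sum, map_sum, map_sum]
    refine Finset.sum_congr rfl fun i _ => ?_
    have hm := hD i _ (hpm i x)
    by_cases hk : k = i
    · rw [hk, hpi _ _ hm, hpi _ _ (hpm i x)]
    · rw [hp0 _ _ hk _ (hpm i x), hp0 _ _ (by omega) _ hm, map_zero, map_zero]
  -- The left side is the component of degree $e_u - e_w$ of $\delta_{uw}$; this element is zero or
  -- 1, and 1 has degree 0.
  have hδ : ∀ u w, D (p (e u) (y u) * x w) = if u = w then 1 else 0 := by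
    intro u w
    apply hinj
    rw [hpX _ _ _ _ (hx w), hpD, hy]
    split_ifs with h
    · subst h
      rw [map_one, show e u + (N - e u) - N = 0 by ring, hpi _ _ hone]
    · rw [map_zero, map_zero]
  refine ⟨fun w => p (e w) (y w), fun w => hpm _ _, hδ, fun f => ?_⟩
  -- Both linear forms take the same values on the $x_u$, which span, so the expansion is
  -- unaffected.
  have h1 : ∀ w, D (p (e w) (y w) * f) = D (y w * f) := by
    intro w
    conv_lhs => rw [hy' f]
    rw [Finset.mul_sum, map_sum, Finset.sum_eq_single w]
    · rw [mul_smul_comm, map_smul, hδ, if_pos rfl, smul_eq_mul, mul_one]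
    · intro u _ hu
      rw [mul_smul_comm, map_smul, hδ, if_neg hu.symm, smul_zero]
    · intro h
      exact (h (Finset.mem_univ w)).elim
  simp only [h1]
  exact hy' f

end Homogeneous

/-! ### The Gram matrix of the elements $\Delta_w(\mu_J)$. -/

section Gram

variable {ι : Type*} {V : Type u} {V' : Type*} [AddCommGroup V] [Module ℂ V] [AddCommGroup V']
  [Module ℂ V'] {P : RootPairing ι ℂ V V'} (b : P.Base) {J : Set b.support}
  {red : parabolic b J → List b.support}

theorem wordProd_reverse_append (hred : ∀ w, IsReducedExpr b w.1 (red w)) (u w : parabolic b J) :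
    wordProd b ((red u).reverse ++ red w) = u.1⁻¹ * w.1 := by
  rw [wordProd_append, wordProd_reverse, show wordProd b (red u) = u.1 from (hred u).1,
    show wordProd b (red w) = w.1 from (hred w).1]

theorem length_reverse_append (hred : ∀ w, IsReducedExpr b w.1 (red w)) (u w : parabolic b J) :
    ((red u).reverse ++ red w).length = weylLength b u.1 + weylLength b w.1 := by
  rw [List.length_append, List.length_reverse, (hred u).2, (hred w).2]

section

variable [Finite ι] [P.IsCrystallographic] [P.IsReduced]

variable (J) in
theorem mem_of_mem_reducedExpr {w : P.weylGroup} (hw : w ∈ parabolic b J) {l : List b.support}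
    (hl : IsReducedExpr b w l) {t : b.support} (ht : t ∈ l) : t ∈ J := by
  obtain ⟨h1, h2⟩ := hl
  obtain rfl : wordProd b l = w := h1
  exact mem_of_mem_reduced b J h2 hw ht

theorem mem_of_mem_reverse_append (hred : ∀ w, IsReducedExpr b w.1 (red w)) (u w : parabolic b J)
    {t : b.support} (ht : t ∈ (red u).reverse ++ red w) : t ∈ J := by
  rcases List.mem_append.1 ht with ht | ht
  · exact mem_of_mem_reducedExpr b J u.2 (hred u) (List.mem_reverse.1 ht)
  · exact mem_of_mem_reducedExpr b J w.2 (hred w) ht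

end

variable [Finite ι] [P.IsCrystallographic] [P.IsReduced] [P.IsRootSystem]

attribute [local instance] coinvAlgebra coinvModule

theorem coinvTop_mul (hred : ∀ w, IsReducedExpr b w.1 (red w)) (u w : parabolic b J) :
    (coinvTop b J
      (Ideal.Quotient.mk (coinvIdeal P) (demazureWord b (red u) (rootProd b J)) *
        Ideal.Quotient.mk (coinvIdeal P) (demazureWord b (red w) (rootProd b J))) : CoinvAlg P) =
      Ideal.Quotient.mk (coinvIdeal P) (demazureTop b J (rootProd b J *
        demazureWord b ((red u).reverse ++ red w) (rootProd b J))) := by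
  rw [← map_mul, coinvTop_mk, demazureTop_demazureWord_mul b
    (fun t => mem_of_mem_reducedExpr b J u.2 (hred u)), demazureWord_append]

theorem coinvTop_mul_eq_zero_of_length (hred : ∀ w, IsReducedExpr b w.1 (red w))
    {u w : parabolic b J}
    (h : weylLength b (longest b J) < weylLength b u.1 + weylLength b w.1) :
    coinvTop b J
      (Ideal.Quotient.mk (coinvIdeal P) (demazureWord b (red u) (rootProd b J)) *
        Ideal.Quotient.mk (coinvIdeal P) (demazureWord b (red w) (rootProd b J))) = 0 := by
  apply Subtype.ext
  rw [coinvTop_mul b hred, demazureWord_eq_zero_of_length b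
    (fun t => mem_of_mem_reverse_append b hred u w) (by rwa [length_reverse_append b hred]),
    mul_zero, map_zero, map_zero]
  rfl

theorem coinvTop_mul_eq_zero_of_ne (hred : ∀ w, IsReducedExpr b w.1 (red w))
    {u w : parabolic b J}
    (h : weylLength b u.1 + weylLength b w.1 = weylLength b (longest b J))
    (hne : u.1⁻¹ * w.1 ≠ longest b J) :
    coinvTop b J
      (Ideal.Quotient.mk (coinvIdeal P) (demazureWord b (red u) (rootProd b J)) *
        Ideal.Quotient.mk (coinvIdeal P) (demazureWord b (red w) (rootProd b J))) = 0 := by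
  apply Subtype.ext
  rw [coinvTop_mul b hred, demazureWord_eq_zero_of_ne b
    (fun t => mem_of_mem_reverse_append b hred u w) (by rwa [length_reverse_append b hred])
    (by rwa [wordProd_reverse_append b hred]), mul_zero, map_zero, map_zero]
  rfl

theorem exists_coinvTop_mul_eq (hred : ∀ w, IsReducedExpr b w.1 (red w)) :
    ∃ c : ℂ, c ≠ 0 ∧ ∀ u w : parabolic b J,
    weylLength b u.1 + weylLength b w.1 = weylLength b (longest b J) →
    u.1⁻¹ * w.1 = longest b J →
    coinvTop b J
      (Ideal.Quotient.mk (coinvIdeal P) (demazureWord b (red u) (rootProd b J)) *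
        Ideal.Quotient.mk (coinvIdeal P) (demazureWord b (red w) (rootProd b J))) =
      algebraMap ℂ _ c := by
  obtain ⟨c, hc, h⟩ := exists_demazureTop_rootProd b J
  refine ⟨c * c, mul_ne_zero hc hc, fun u w h1 h2 => ?_⟩
  apply Subtype.ext
  rw [coinvTop_mul b hred, demazureWord_eq_top b (by rwa [length_reverse_append b hred])
    (by rwa [wordProd_reverse_append b hred]), h, mul_comm, ← Algebra.smul_def, map_smul, h,
    Algebra.smul_def, ← map_mul]
  rfl

/-- Twisting the rows by $w_J$ puts the entries with $\ell(vw_J) + \ell(w) = \ell(w_J)$ into the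
diagonal blocks $\ell(v) = \ell(w)$. -/
theorem isUnit_gram [Fintype (parabolic b J)] [DecidableEq (parabolic b J)]
    (hred : ∀ w, IsReducedExpr b w.1 (red w)) :
    IsUnit (Matrix.of fun v w : parabolic b J => coinvTop b J
      (Ideal.Quotient.mk (coinvIdeal P)
        (demazureWord b (red (v * ⟨longest b J, longest_mem b J⟩)) (rootProd b J)) *
        Ideal.Quotient.mk (coinvIdeal P) (demazureWord b (red w) (rootProd b J)))).det := by
  set G := Matrix.of fun v w : parabolic b J => coinvTop b J
      (Ideal.Quotient.mk (coinvIdeal P)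
        (demazureWord b (red (v * ⟨longest b J, longest_mem b J⟩)) (rootProd b J)) *
        Ideal.Quotient.mk (coinvIdeal P) (demazureWord b (red w) (rootProd b J))) with hG
  obtain ⟨c, hc, hcG⟩ := exists_coinvTop_mul_eq b hred
  have hlen : ∀ v : parabolic b J,
      weylLength b (v * ⟨longest b J, longest_mem b J⟩ : parabolic b J).1 + weylLength b v.1 =
        weylLength b (longest b J) := fun v => by
    rw [← weylLength_longest_mul b J (inv_mem v.2), weylLength_inv b v.1, Subgroup.coe_mul,
      ← weylLength_inv, mul_inv_rev, longest_inv]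
  -- For $\ell(w) > \ell(v)$ the word for $(vw_J)^{-1}w$ is longer than $\ell(w_J)$. The minus sign
  -- fits the orientation of `BlockTriangular`.
  have htri : G.BlockTriangular fun v => - (weylLength b v.1 : ℤ) := fun v w hvw => by
    refine coinvTop_mul_eq_zero_of_length b hred ?_
    have := hlen v
    have h2 : -(weylLength b w.1 : ℤ) < -(weylLength b v.1 : ℤ) := hvw
    omega
  rw [htri.det]
  refine IsUnit.prod_iff.2 fun a _ => ?_
  -- In a block of constant length, $(vw_J)^{-1}w = w_J v^{-1}w$ equals $w_J$ only for $v = w$.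
  have hdiag : G.toSquareBlock (fun v => - (weylLength b v.1 : ℤ)) a =
      Matrix.diagonal fun _ => algebraMap ℂ (coinvInv b J) c := by
    ext1 v w
    have hvw : weylLength b w.1.1 = weylLength b v.1.1 := by
      have h1 : -(weylLength b v.1.1 : ℤ) = a := v.2
      have h2 : -(weylLength b w.1.1 : ℤ) = a := w.2
      omega
    have hsum := hlen v.1
    rw [← hvw] at hsum
    by_cases h : v = w
    · subst h
      rw [Matrix.diagonal_apply_eq]
      refine hcG _ _ hsum ?_
      rw [Subgroup.coe_mul, mul_inv_rev, longest_inv, mul_assoc, inv_mul_cancel, mul_one]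
    · rw [Matrix.diagonal_apply_ne _ h]
      refine coinvTop_mul_eq_zero_of_ne b hred hsum fun h' => h ?_
      rw [Subgroup.coe_mul, mul_inv_rev, longest_inv, mul_assoc, mul_eq_left,
        inv_mul_eq_one] at h'
      exact Subtype.ext (Subtype.ext h')
  rw [hdiag, Matrix.det_diagonal]
  exact IsUnit.prod_iff.2 fun _ _ => (IsUnit.mk0 c hc).map (algebraMap ℂ (coinvInv b J))

/-- The elements `Δ_w(μ_J)` have a homogeneous dual basis with respect to `Δ_{w_J}`. -/
theorem exists_coinv_dual_basis [Fintype (parabolic b J)] [DecidableEq (parabolic b J)]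
    (hred : ∀ w, IsReducedExpr b w.1 (red w)) :
    ∃ y : parabolic b J → CoinvAlg P,
      (∀ w, y w ∈ coinvDeg P (2 * (weylLength b w.1 : ℤ))) ∧
      (∀ u w, coinvTop b J (y u * Ideal.Quotient.mk (coinvIdeal P)
        (demazureWord b (red w) (rootProd b J))) = if u = w then 1 else 0) ∧
      ∀ f, f = ∑ w, coinvTop b J (y w * f) •
        Ideal.Quotient.mk (coinvIdeal P) (demazureWord b (red w) (rootProd b J)) := by
  set X : parabolic b J → CoinvAlg P := fun w => Ideal.Quotient.mk (coinvIdeal P)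
        (demazureWord b (red w) (rootProd b J)) with hX
  let e : parabolic b J ≃ parabolic b J := Equiv.mulRight ⟨longest b J, longest_mem b J⟩
  obtain ⟨y, hy, hy'⟩ := exists_dual_basis (coinvTop b J) X (fun v => X (e v)) (isUnit_gram b hred)
    (fun f hf => eq_zero_of_coinvTop b J hred fun w => by simpa [e] using hf (e.symm w))
  refine exists_homogeneous_dual_basis Subtype.val_injective (coinvDeg_isInternal P)
    (coinvDeg_mul P) ⟨1, one_mem_symDeg, rfl⟩ (coinvTop b J)
    (2 * (weylLength b (longest b J) : ℤ)) (fun d x hx => coinvTop_mem b J hx) (fun w => ?_) hy hy'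
  exact ⟨_, (hred w).2 ▸ demazureWord_mem_symDeg b (red w) (rootProd_mem_symDeg b J), rfl⟩

end Gram

end Coinvariant

namespace GradedRep.FinGrMod

/-! ### Compatibility of induction and restriction with grading shifts. -/

section Shift

variable {K : Type v} [Field K] {A B : Type u} [CommRing A] [Algebra K A] [CommRing B] [Algebra K B]
  [Algebra A B] [IsScalarTower K A B] {𝒜 : ℤ → Submodule K A} {ℬ : ℤ → Submodule K B}

theorem isGradedFunctor_res (h : ∀ d, ∀ a ∈ 𝒜 d, algebraMap A B a ∈ ℬ d) :
    IsGradedFunctor (res h) := fun _ =>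
  ⟨NatIso.ofComponents (fun _ =>
    { hom := ⟨LinearMap.id, fun _ _ hm => hm⟩
      inv := ⟨LinearMap.id, fun _ _ hm => hm⟩
      hom_inv_id := rfl
      inv_hom_id := rfl }) fun _ => rfl⟩

theorem tensorDeg_shift (N : FinGrMod 𝒜) (k d : ℤ) :
    tensorDeg ℬ ((shift k).obj N) d = tensorDeg ℬ N (d - k) := by
  refine le_antisymm (Submodule.span_mono ?_) (Submodule.span_mono ?_)
  · rintro x ⟨i, j, b, n, hij, hb, hn, rfl⟩
    exact ⟨i, j - k, b, n, by omega, hb, hn, rfl⟩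
  · rintro x ⟨i, j, b, n, hij, hb, hn, rfl⟩
    refine ⟨i, j + k, b, n, by omega, hb, ?_, rfl⟩
    change n ∈ N.deg (j + k - k)
    rwa [add_sub_cancel_right]

variable [Module.Finite A B] (h𝒜 : DirectSum.IsInternal 𝒜) (hℬ : DirectSum.IsInternal ℬ)
  (hmul : ∀ i j, ∀ x ∈ ℬ i, ∀ y ∈ ℬ j, x * y ∈ ℬ (i + j))
  (h : ∀ d, ∀ a ∈ 𝒜 d, algebraMap A B a ∈ ℬ d)

theorem isGradedFunctor_ind : IsGradedFunctor (ind h𝒜 hℬ hmul h) := fun k =>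
  ⟨NatIso.ofComponents (fun N =>
    { hom := ⟨LinearMap.id, fun d _ hm => (tensorDeg_shift (ℬ := ℬ) N k d).le hm⟩
      inv := ⟨LinearMap.id, fun d _ hm => (tensorDeg_shift (ℬ := ℬ) N k d).ge hm⟩
      hom_inv_id := rfl
      inv_hom_id := rfl }) fun _ => rfl⟩

end Shift

end GradedRep.FinGrMod

/-! ### Frobenius extensions -/

namespace Frobenius

variable {A B : Type*} [CommRing A] [CommRing B] [Algebra A B] {I : Type*} [Fintype I]
  {D : B →ₗ[A] A} {x y : I → B}

/-- The roles of $x$ and $y$ can be exchanged: the error term is orthogonal to all $x_w$, hence to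
their span, which contains every $y_w$. -/
theorem dual_expansion [DecidableEq I] (hy : ∀ u w, D (y u * x w) = if u = w then 1 else 0)
    (hy' : ∀ f, f = ∑ w, D (y w * f) • x w) (f : B) : f = ∑ w, D (f * x w) • y w := by
  rw [← sub_eq_zero]
  set g := f - ∑ w, D (f * x w) • y w with hg
  have h1 : ∀ w, D (g * x w) = 0 := fun w => by
    rw [hg, sub_mul, map_sub, Finset.sum_mul, map_sum, Finset.sum_eq_single w]
    · rw [smul_mul_assoc, map_smul, hy, if_pos rfl, smul_eq_mul, mul_one, sub_self]
    · intro u _ hu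
      rw [smul_mul_assoc, map_smul, hy, if_neg hu, smul_zero]
    · intro h
      exact (h (Finset.mem_univ w)).elim
  rw [hy' g]
  refine Finset.sum_eq_zero fun w _ => ?_
  have h2 : D (y w * g) = 0 := by
    rw [hy' (y w), Finset.sum_mul, map_sum]
    refine Finset.sum_eq_zero fun u _ => ?_
    rw [smul_mul_assoc, map_smul, mul_comm (x u) g, h1, smul_zero]
  rw [h2, zero_smul]

section Contract

variable (D) (N : Type*) [AddCommGroup N] [Module A N]

/-- The `A`-linear map `B ⊗ N → N` induced by a linear form `B → A`. -/
noncomputable def contract : B ⊗[A] N →ₗ[A] N :=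
  (TensorProduct.lid A N).toLinearMap ∘ₗ D.rTensor N

theorem contract_tmul (c : B) (n : N) : contract D N (c ⊗ₜ n) = D c • n := by
  simp [contract]

variable {D N}

/-- A map into $B \otimes N$ is recovered from its contraction; this is one half of the adjunction
bijection. -/
theorem sum_tmul_contract (hy' : ∀ f, f = ∑ w, D (y w * f) • x w) (t : B ⊗[A] N) :
    ∑ w, x w ⊗ₜ[A] contract D N (y w • t) = t := by
  induction t using TensorProduct.induction_on with
  | zero => simp
  | add t t' ht ht' =>
    simp only [smul_add, map_add, TensorProduct.tmul_add, Finset.sum_add_distrib, ht, ht']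
  | tmul c n =>
    simp only [TensorProduct.smul_tmul', contract_tmul, smul_eq_mul, TensorProduct.tmul_smul]
    rw [← TensorProduct.sum_tmul, ← hy' c]

end Contract

variable {M N : Type*} [AddCommGroup M] [Module A M] [Module B M] [IsScalarTower A B M]
  [AddCommGroup N] [Module A N] [DecidableEq I]

/-- The `B`-linear map `m ↦ ∑ x_w ⊗ g(y_w m)`. -/
noncomputable def expand (hy : ∀ u w, D (y u * x w) = if u = w then 1 else 0)
    (hy' : ∀ f, f = ∑ w, D (y w * f) • x w) (g : M →ₗ[A] N) : M →ₗ[B] B ⊗[A] N where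
  toFun m := ∑ w, x w ⊗ₜ[A] g (y w • m)
  map_add' m m' := by
    simp only [smul_add, map_add, TensorProduct.tmul_add, Finset.sum_add_distrib]
  map_smul' c m := by
    rw [RingHom.id_apply, Finset.smul_sum]
    -- Together with the expansion of $c x_u$ in the $x_w$ below, this says that the Casimir element
    -- $\sum_w x_w \otimes y_w$ commutes with $c$.
    have h1 : ∀ w, g (y w • c • m) = ∑ u, D (y w * c * x u) • g (y u • m) := fun w => by
      conv_lhs => rw [smul_smul, dual_expansion hy hy' (y w * c), Finset.sum_smul, map_sum]
      simp only [smul_assoc, map_smul]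
    simp only [h1, TensorProduct.tmul_sum, TensorProduct.tmul_smul, TensorProduct.smul_tmul']
    rw [Finset.sum_comm]
    refine Finset.sum_congr rfl fun u _ => ?_
    rw [← TensorProduct.sum_tmul, smul_eq_mul]
    simp only [mul_assoc]
    rw [← hy' (c * x u)]

theorem contract_expand (hy : ∀ u w, D (y u * x w) = if u = w then 1 else 0)
    (hy' : ∀ f, f = ∑ w, D (y w * f) • x w) (g : M →ₗ[A] N) (m : M) :
    contract D N (expand hy hy' g m) = g m := by
  change contract D N (∑ w, x w ⊗ₜ[A] g (y w • m)) = g m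
  -- The identity $1 = \sum_w D(x_w)\,y_w$ is what makes contraction undo the expansion.
  have h1 := dual_expansion hy hy' 1
  simp only [one_mul] at h1
  simp only [map_sum, contract_tmul]
  simp only [← map_smul, ← smul_assoc, ← map_sum, ← Finset.sum_smul]
  rw [← h1, one_smul]

end Frobenius

/-! ### Adjunctions between induction and restriction -/

namespace GradedRep.FinGrMod

open Frobenius

section Restriction

variable {K : Type v} [Field K] {A B : Type u} [CommRing A] [CommRing B] [Algebra K B]
  [Algebra A B] {ℬ : ℤ → Submodule K B}

/-- The restriction to `A` of the module structure of a graded `B`-module. -/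
abbrev resModule (M : FinGrMod ℬ) : Module A M.carrier :=
  Module.compHom M.carrier (algebraMap A B)

attribute [local instance] resModule

theorem resModule_isScalarTower (M : FinGrMod ℬ) : IsScalarTower A B M.carrier :=
  ⟨fun a b m => by
    change (a • b) • m = algebraMap A B a • b • m
    rw [Algebra.smul_def, mul_smul]⟩

end Restriction

section Adjunction

variable {K : Type v} [Field K] {A B : Type u} [CommRing A] [Algebra K A] [CommRing B] [Algebra K B]
  [Algebra A B] [IsScalarTower K A B] {𝒜 : ℤ → Submodule K A} {ℬ : ℤ → Submodule K B}

attribute [local instance] resModule resModule_isScalarTower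

theorem map_mem_of_mem_tensorDeg {X : Type*} [AddCommGroup X] [Module K X] {N : FinGrMod 𝒜}
    (f : B ⊗[A] N.carrier →ₗ[K] X) {S : Submodule K X} {d : ℤ}
    (hf : ∀ i j c n, i + j = d → c ∈ ℬ i → n ∈ N.deg j → f (c ⊗ₜ n) ∈ S)
    {t : B ⊗[A] N.carrier} (ht : t ∈ tensorDeg ℬ N d) : f t ∈ S := by
  refine (Submodule.span_le (p := S.comap f)).2 ?_ ht
  rintro _ ⟨i, j, c, n, hij, hc, hn, rfl⟩
  exact hf i j c n hij hc hn

variable [Module.Finite A B] (h𝒜 : DirectSum.IsInternal 𝒜) (hℬ : DirectSum.IsInternal ℬ)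
  (hmul : ∀ i j, ∀ x ∈ ℬ i, ∀ y ∈ ℬ j, x * y ∈ ℬ (i + j))
  (h : ∀ d, ∀ a ∈ 𝒜 d, algebraMap A B a ∈ ℬ d)

/-- The linear map underlying a morphism to a restriction. -/
def toRes {N : FinGrMod 𝒜} {M : FinGrMod ℬ} (ψ : N ⟶ (res h).obj M) :
    N.carrier →ₗ[A] M.carrier := ψ.toLinearMap

/-- The linear map underlying a morphism from a restriction. -/
def ofRes {M : FinGrMod ℬ} {N : FinGrMod 𝒜} (ψ : (res h).obj M ⟶ N) :
    M.carrier →ₗ[A] N.carrier := ψ.toLinearMap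

/-- The linear map underlying a morphism from an induced module. -/
noncomputable def ofInd {N : FinGrMod 𝒜} {M : FinGrMod ℬ} (φ : (ind h𝒜 hℬ hmul h).obj N ⟶ M) :
    B ⊗[A] N.carrier →ₗ[B] M.carrier := φ.toLinearMap

/-- The linear map underlying a morphism to an induced module with shifted grading. -/
noncomputable def toInd {N : FinGrMod 𝒜} {M : FinGrMod ℬ} {k : ℤ}
    (φ : M ⟶ (ind h𝒜 hℬ hmul h ⋙ shift k).obj N) :
    M.carrier →ₗ[B] B ⊗[A] N.carrier := φ.toLinearMap

/-- The graded morphism `B ⊗ N → M` attached to a graded morphism from `N` to the restriction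
of `M`. -/
noncomputable def extendHom {N : FinGrMod 𝒜} {M : FinGrMod ℬ} (ψ : N ⟶ (res h).obj M) :
    (ind h𝒜 hℬ hmul h).obj N ⟶ M where
  toLinearMap := LinearMap.liftBaseChange B (toRes h ψ)
  map_mem d t ht := by
    refine map_mem_of_mem_tensorDeg
      ((LinearMap.liftBaseChange B (toRes h ψ)).restrictScalars K) ?_ ht
    rintro i j c n rfl hc hn
    rw [LinearMap.restrictScalars_apply, LinearMap.liftBaseChange_tmul]
    exact M.smul_mem i j c _ hc (ψ.map_mem j n hn)

/-- The graded morphism from `N` to the restriction of `M` attached to a graded morphism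
`B ⊗ N → M`. -/
noncomputable def restrictHom (hone : 1 ∈ ℬ 0) {N : FinGrMod 𝒜} {M : FinGrMod ℬ}
    (φ : (ind h𝒜 hℬ hmul h).obj N ⟶ M) : N ⟶ (res h).obj M where
  toLinearMap := (ofInd h𝒜 hℬ hmul h φ).restrictScalars A ∘ₗ TensorProduct.mk A B N.carrier 1
  map_mem d n hn := by
    have := tmul_mem_tensorDeg hone hn
    rw [zero_add] at this
    exact φ.map_mem d _ this

theorem nonempty_ind_adj_res (hone : 1 ∈ ℬ 0) :
    Nonempty (ind h𝒜 hℬ hmul h ⊣ res h) := by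
  refine ⟨Adjunction.mkOfHomEquiv
    { homEquiv := fun N M =>
        { toFun := restrictHom h𝒜 hℬ hmul h hone
          invFun := extendHom h𝒜 hℬ hmul h
          left_inv := fun φ => ?_
          right_inv := fun ψ => ?_ }
      homEquiv_naturality_left_symm := ?_
      homEquiv_naturality_right := ?_ }⟩
  · apply hom_ext
    change LinearMap.liftBaseChange B ((ofInd h𝒜 hℬ hmul h φ).restrictScalars A ∘ₗ
      TensorProduct.mk A B N.carrier 1) = ofInd h𝒜 hℬ hmul h φ
    refine TensorProduct.AlgebraTensorModule.curry_injective ?_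
    ext n
    simp
  · apply hom_ext
    change (LinearMap.liftBaseChange B (toRes h ψ)).restrictScalars A ∘ₗ
      TensorProduct.mk A B N.carrier 1 = toRes h ψ
    ext n
    simp
  · intro N N' M f ψ
    apply hom_ext
    change LinearMap.liftBaseChange B (toRes h ψ ∘ₗ f.toLinearMap) =
      LinearMap.liftBaseChange B (toRes h ψ) ∘ₗ f.toLinearMap.baseChange B
    refine TensorProduct.AlgebraTensorModule.curry_injective ?_
    ext n
    simp
  · intros
    rfl

variable {I : Type*} [Fintype I] [DecidableEq I] {D : B →ₗ[A] A} {x y : I → B}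

/-- Restriction along a graded Frobenius extension is left adjoint to the shifted induction. -/
theorem nonempty_res_adj_ind {k : ℤ} {e : I → ℤ} (hD : ∀ d, ∀ c ∈ ℬ d, D c ∈ 𝒜 (d - k))
    (hx : ∀ w, x w ∈ ℬ (k - e w)) (hye : ∀ w, y w ∈ ℬ (e w))
    (hy : ∀ u w, D (y u * x w) = if u = w then 1 else 0)
    (hy' : ∀ f, f = ∑ w, D (y w * f) • x w) :
    Nonempty (res h ⊣ ind h𝒜 hℬ hmul h ⋙ shift (-k)) := by
  refine ⟨Adjunction.mkOfHomEquiv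
    { homEquiv := fun M N =>
        { toFun := fun g => ⟨expand hy hy' (ofRes h g), fun d m hm => ?_⟩
          invFun := fun φ => ⟨contract D N.carrier ∘ₗ
            (toInd h𝒜 hℬ hmul h φ).restrictScalars A, fun d m hm => ?_⟩
          left_inv := fun g => ?_
          right_inv := fun φ => ?_ }
      homEquiv_naturality_left_symm := ?_
      homEquiv_naturality_right := ?_ }⟩
  · change (∑ w, x w ⊗ₜ[A] ofRes h g (y w • m)) ∈ tensorDeg ℬ N (d - -k)
    refine sum_mem fun w _ => ?_
    have := tmul_mem_tensorDeg (hx w)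
      (g.map_mem _ _ (M.smul_mem (e w) d (y w) m (hye w) hm))
    -- Each term of the Casimir sum raises degrees by exactly $k$, which the shift by $-k$
    -- compensates.
    rwa [show k - e w + (e w + d) = d - -k by ring] at this
  · refine map_mem_of_mem_tensorDeg (ℬ := ℬ) (d := d - -k)
      ((contract D N.carrier).restrictScalars K) ?_ (φ.map_mem d m hm)
    intro i j c n hij hc hn
    rw [LinearMap.restrictScalars_apply, contract_tmul, show d = i - k + j by omega]
    exact N.smul_mem _ _ _ _ (hD i c hc) hn
  · apply hom_ext
    exact LinearMap.ext (contract_expand hy hy' (ofRes h g))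
  · apply hom_ext
    refine LinearMap.ext fun m => ?_
    change ∑ w, x w ⊗ₜ[A] contract D N.carrier (toInd h𝒜 hℬ hmul h φ (y w • m)) =
      toInd h𝒜 hℬ hmul h φ m
    simp only [map_smul]
    exact sum_tmul_contract hy' _
  · intros
    rfl
  · intro M N N' f g
    apply hom_ext
    refine LinearMap.ext fun m => ?_
    change ∑ w, x w ⊗ₜ[A] g.toLinearMap (ofRes h f (y w • m)) =
      g.toLinearMap.baseChange B (∑ w, x w ⊗ₜ[A] ofRes h f (y w • m))
    simp only [map_sum, LinearMap.baseChange_tmul]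

end Adjunction

end GradedRep.FinGrMod

namespace Coinvariant

open GradedRep

/-- Duality gives linear independence and the expansion gives spanning. -/
theorem exists_basis_of_dual {A B I : Type*} [CommRing A] [CommRing B] [Algebra A B] [Fintype I]
    [DecidableEq I] (D : B →ₗ[A] A) (x y : I → B)
    (hy : ∀ u w, D (y u * x w) = if u = w then 1 else 0)
    (hy' : ∀ f, f = ∑ w, D (y w * f) • x w) : ∃ β : Module.Basis I A B, ∀ w, β w = x w := by
  have hli : LinearIndependent A x := by
    rw [Fintype.linearIndependent_iff]
    intro g hg u
    have := congrArg (fun t => D (y u * t)) hg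
    simpa [Finset.mul_sum, hy] using this
  refine ⟨Module.Basis.mk hli ?_, fun w => Module.Basis.mk_apply _ _ w⟩
  intro f _
  rw [hy' f]
  exact sum_mem fun w _ => Submodule.smul_mem _ _ (Submodule.subset_span ⟨w, rfl⟩)

/-! ### The Frobenius structure applied to $C^J \subset C$. -/

section Coinv

variable {ι : Type*} {V : Type u} {V' : Type*} [AddCommGroup V] [Module ℂ V] [AddCommGroup V']
  [Module ℂ V'] {P : RootPairing ι ℂ V V'} [Finite ι] [P.IsCrystallographic] [P.IsReduced]
  [P.IsRootSystem] (b : P.Base) (J : Set b.support)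

theorem exists_coinv_basis {red : parabolic b J → List b.support}
    (hred : ∀ w, IsReducedExpr b w.1 (red w)) :
    ∃ β : Module.Basis (parabolic b J) (coinvInv b J) (CoinvAlg P),
      ∀ w, β w = Ideal.Quotient.mk (coinvIdeal P) (demazureWord b (red w) (rootProd b J)) := by
  classical
  let _ : Fintype (parabolic b J) := Fintype.ofFinite _
  obtain ⟨y, -, hy, hy'⟩ := exists_coinv_dual_basis b hred
  let _ := coinvAlgebra b J
  exact exists_basis_of_dual (coinvTop b J) _ _ hy hy'

theorem nonempty_resC_adj_indC :
    Nonempty (resC b J ⊣ indC b J ⋙ FinGrMod.shift (-2 * (weylLength b (longest b J) : ℤ))) := by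
  classical
  let _ : Fintype (parabolic b J) := Fintype.ofFinite _
  choose red hred using fun w : parabolic b J => exists_isReducedExpr b w.1
  obtain ⟨y, hym, hy, hy'⟩ := exists_coinv_dual_basis b hred
  rw [neg_mul]
  let _ := coinvAlgebra b J
  refine FinGrMod.nonempty_res_adj_ind (D := coinvTop b J) (coinvInvDeg_isInternal b J)
    (coinvDeg_isInternal P) (coinvDeg_mul P) (algebraMap_mem_coinvDeg b J)
    (e := fun w : parabolic b J => 2 * (weylLength b w.1 : ℤ)) (fun d c hc => coinvTop_mem b J hc)
    (fun w => ?_) hym hy hy'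
  exact ⟨_, (hred w).2 ▸ demazureWord_mem_symDeg b (red w) (rootProd_mem_symDeg b J), rfl⟩

end Coinv

end Coinvariant

open GradedRep Coinvariant
theorem mainTheorem3 {𝔤 : Type u} [LieRing 𝔤] [LieAlgebra ℂ 𝔤] [FiniteDimensional ℂ 𝔤]
    [LieAlgebra.IsSemisimple ℂ 𝔤] (𝔥 : LieSubalgebra ℂ 𝔤) [𝔥.IsCartanSubalgebra]
    (b : (LieAlgebra.IsKilling.rootSystem 𝔥).Base) (J : Set b.support) :
    Module.Free (coinvInv b J) (CoinvAlg (LieAlgebra.IsKilling.rootSystem 𝔥)) ∧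
    (∀ red : parabolic b J → List b.support, (∀ w, IsReducedExpr b w.1 (red w)) →
      ∃ B : Module.Basis (parabolic b J) (coinvInv b J)
          (CoinvAlg (LieAlgebra.IsKilling.rootSystem 𝔥)),
        ∀ w, B w = Ideal.Quotient.mk (coinvIdeal (LieAlgebra.IsKilling.rootSystem 𝔥))
          (demazureWord b (red w) (rootProd b J))) ∧
    FinGrMod.IsGradedFunctor (indC b J) ∧
    FinGrMod.IsGradedFunctor (resC b J) ∧
    Nonempty (indC b J ⊣ resC b J) ∧
    Nonempty (resC b J ⊣ indC b J ⋙ FinGrMod.shift (-2 * (weylLength b (longest b J) : ℤ))) := by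
  -- This choice of reduced words serves only to obtain freeness; the basis statement holds for
  -- every choice.
  choose red hred using fun w : parabolic b J => exists_isReducedExpr b w.1
  obtain ⟨β, -⟩ := exists_coinv_basis b J hred
  exact ⟨Module.Free.of_basis β, fun red hred => exists_coinv_basis b J hred,
    FinGrMod.isGradedFunctor_ind _ _ _ _, FinGrMod.isGradedFunctor_res _,
    FinGrMod.nonempty_ind_adj_res _ _ _ _ ⟨1, one_mem_symDeg, rfl⟩, nonempty_resC_adj_indC b J⟩
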